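/- There are absolute constants $C_1, C_h, C_\mu > 0$ such that the following holds. Let $n > 10$, $d \ge 2$, let $f_1,\dots,f_n:\mathbb{R}^d\to\mathbb{R}$ be twice continuously differentiable with, for all $i,x,y$ and some $L_1,L_2>0$, $$\|\nabla f_i(x)-\nabla f_i(y)\|_2\le L_1\|x-y\|_2,\qquad \|\nabla^2 f_i(x)-\nabla^2 f_i(y)\|_2\le L_2\|x-y\|_2$$ (Euclidean and spectral norm), let $F=\frac1n\sum_{i=1}^n f_i$ be bounded below, let $\hat x^0\in\mathbb{R}^d$, and put $\Delta_F=F(\hat x^0)-\inf_x F(x)$. Let $S,T\ge 1$ be integers, $D_g>0$, $D_h>25\log d$, and $M_{s,t}>2L_2$ for $1\le s\le S$, $0\le t\le T-1$. The Lite-SVRC algorithm runs epochs $s=1,\dots,S$. Epoch $s$ starts at $x_0^s=\hat x^{s-1}$ and, for $t=0,\dots,T-1$, sets $x_{t+1}^s=x_t^s+h_t^s$, where $$h_t^s\in\operatorname*{argmin}_{h\in\mathbb{R}^d}\ \langle v_t^s,h\rangle+\tfrac12\langle U_t^s h,h\rangle+\tfrac{M_{s,t}}{6}\|h\|_2^3;$$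 it ends with $\hat x^s=x_T^s$. Ties in the argmin are broken by a rule that may depend on $s,t$, the points produced so far, $v_t^s$ and $U_t^s$. For $t=0$, $v_0^s=\nabla F(\hat x^{s-1})$ and $U_0^s=\nabla^2F(\hat x^{s-1})$. For $t\ge1$, independently of each other and of the past, $I_g$ and $I_h$ are drawn uniformly with replacement from $\{1,\dots,n\}$, with sizes $b_{s,t}=\lceil D_g/\|x_t^s-\hat x^{s-1}\|_2^2\rceil$ and $B_{s,t}=\lceil D_h\rceil$, and $$v_t^s=\frac1{b_{s,t}}\sum_{i\in I_g}\big[\nabla f_i(x_t^s)-\nabla f_i(\hat x^{s-1})\big]+\nabla F(\hat x^{s-1}),\qquad U_t^s=\frac1{B_{s,t}}\sum_{j\in I_h}\big[\nabla^2 f_j(x_t^s)-\nabla^2 f_j(\hat x^{s-1})\big]+\nabla^2F(\hat x^{s-1})$$ (with $v_t^s=\nabla F(\hat x^{s-1})$ if $x_t^s=\hat x^{s-1}$). The output is $x_{\rm out}=x_{t+1}^s$ with $(s,t)$ uniform on $\{1,\dots,S\}\times\{0,\dots,T-1\}$ and independent of the run. For $(s,t)$ in this set put $$\mu(x_{t+1}^s)=\max\Big\{\|\nabla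 F(x_{t+1}^s)\|_2^{3/2},\ -\big(\lambda_{\min}(\nabla^2F(x_{t+1}^s))\big)^3M_{s,t}^{-3/2}\Big\}.$$ Let $\alpha_{s,t},\beta_{s,t}>0$ be arbitrary, and suppose that $\Gamma_{s,t}>0$ and $c_{s,t}>0$ satisfy, for $1\le s\le S$ and $0\le t\le T-1$, with $c_{s,T}=0$, $$\Gamma_{s,t}=\frac{M_{s,t}-12\,c_{s,t+1}(1+2\alpha_{s,t}+\beta_{s,t})}{12M_{s,t}^{3/2}},$$ $$c_{s,t}=\frac{(C_1+\Gamma_{s,t}M_{s,t}^{1/2})L_2^{3/2}}{M_{s,t}^{1/2}}\left(\Big[\frac{4L_1^2}{D_gL_2^2}\Big]^{3/4}+\frac{C_hL_2^{3/2}(\log d)^{3/2}}{M_{s,t}^{3/2}D_h^{3/2}}\right)+c_{s,t+1}\Big(1+\frac1{\alpha_{s,t}^2}+\frac2{\beta_{s,t}^{1/2}}\Big).$$ Then $$\mathbb{E}\,\mu(x_{\rm out})\le\frac{\Delta_F}{S\,T\,\gamma_n},\qquad \gamma_n=\min_{1\le s\le S,\ 0\le t\le T-1}\frac{\Gamma_{s,t}}{C_\mu}.$$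 -/

import Mathlib

open scoped ENNReal

noncomputable section

namespace LiteSVRC

/-- The Euclidean space `ℝ^d`. -/
abbrev Vec (d : ℕ) : Type := EuclideanSpace ℝ (Fin d)

/-- The Hessian `∇² f (x)`, as a linear operator on `ℝ^d`: the derivative of the gradient.
Its operator norm is the spectral norm. -/
def hessian {d : ℕ} (f : Vec d → ℝ) (x : Vec d) : Vec d →L[ℝ] Vec d :=
  fderiv ℝ (gradient f) x

/-- The smallest (real) eigenvalue of an operator. For a symmetric operator on `ℝ^d`, `d ≥ 1`,
the set of eigenvalues is finite and nonempty, so that the infimum is a minimum. -/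
def lambdaMin {d : ℕ} (A : Vec d →L[ℝ] Vec d) : ℝ :=
  sInf {r : ℝ | Module.End.HasEigenvalue (A : Vec d →ₗ[ℝ] Vec d) r}

/-- The objective `F = (1/n) ∑ f_i`. -/
def objective {n d : ℕ} (f : Fin n → Vec d → ℝ) (x : Vec d) : ℝ :=
  (1 / (n : ℝ)) * ∑ i, f i x

/-- The optimality gap `F(x₀) - inf F`. -/
def optimalGap {n d : ℕ} (f : Fin n → Vec d → ℝ) (x₀ : Vec d) : ℝ :=
  objective f x₀ - ⨅ x, objective f x

/-- `μ(x) = max {‖∇F(x)‖^{3/2}, -λ_min(∇²F(x))³ m^{-3/2}}`, for the penalty parameter `m`. -/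
def mu {n d : ℕ} (f : Fin n → Vec d → ℝ) (m : ℝ) (x : Vec d) : ℝ :=
  max (‖gradient (objective f) x‖ ^ (3 / 2 : ℝ))
    (-(lambdaMin (hessian (objective f) x)) ^ 3 * m ^ (-(3 / 2) : ℝ))

/-- The cubic model `⟨v, h⟩ + ½ ⟨U h, h⟩ + (m/6) ‖h‖³`. -/
def cubicModel {d : ℕ} (v : Vec d) (U : Vec d →L[ℝ] Vec d) (m : ℝ) (h : Vec d) : ℝ :=
  inner ℝ v h + (1 / 2) * inner ℝ (U h) h + (m / 6) * ‖h‖ ^ 3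

/-- The semi-stochastic gradient at `x` with reference point `r` and sampled indices `I`.
For an empty batch (which arises only from `x = r`) it is `∇F(r)`. -/
def semiGradient {n d b : ℕ} (f : Fin n → Vec d → ℝ) (r x : Vec d) (I : Fin b → Fin n) : Vec d :=
  (1 / (b : ℝ)) • ∑ k, (gradient (f (I k)) x - gradient (f (I k)) r) + gradient (objective f) r

/-- The semi-stochastic Hessian at `x` with reference point `r` and sampled indices `J`. -/
def semiHessian {n d b : ℕ} (f : Fin n → Vec d → ℝ) (r x : Vec d) (J : Fin b → Fin n) :
    Vec d →L[ℝ] Vec d :=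
  (1 / (b : ℝ)) • ∑ k, (hessian (f (J k)) x - hessian (f (J k)) r) + hessian (objective f) r

/-- The points that a run has produced: `hat s` is the reference point produced by epoch `s`
(and `hat 0` is the initial point), `iter s t` is the `t`-th iterate of epoch `s`. Entries that
have not been computed yet hold an arbitrary value. -/
@[ext] structure Run (d : ℕ) where
  hat : ℕ → Vec d
  iter : ℕ → ℕ → Vec d

/-- Record `y` as the `t`-th iterate of epoch `s`. -/
def Run.setIter {d : ℕ} (ω : Run d) (s t : ℕ) (y : Vec d) : Run d where
  hat := ω.hat
  iter := fun s' t' => if s' = s ∧ t' = t then y else ω.iter s' t'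

/-- Record `y` as the reference point produced by epoch `s`. -/
def Run.setHat {d : ℕ} (ω : Run d) (s : ℕ) (y : Vec d) : Run d where
  hat := fun s' => if s' = s then y else ω.hat s'
  iter := ω.iter

/-- The data of the algorithm. The field `argminRule` is the subproblem solver: `argminRule s t ω v U`
is the step taken at iteration `t` of epoch `s`. It may break ties between several minimizers in any
way, depending on the points produced so far (see `SolvesSubproblems`). -/
structure Algorithm (n d : ℕ) where
  /-- the component functions -/
  f : Fin n → Vec d → ℝ
  /-- the initial point -/
  x₀ : Vec d
  /-- the number of epochs -/
  S : ℕ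
  /-- the epoch length -/
  T : ℕ
  /-- the batch size parameter for gradients -/
  Dg : ℝ
  /-- the batch size parameter for Hessians -/
  Dh : ℝ
  /-- the penalty parameters, indexed by `s ∈ {1, …, S}` and `t ∈ {0, …, T-1}` -/
  M : ℕ → ℕ → ℝ
  argminRule : ℕ → ℕ → Run d → Vec d → (Vec d →L[ℝ] Vec d) → Vec d

namespace Algorithm

variable {n d : ℕ} (A : Algorithm n d)

/-- The index pairs `(s, t)` with `s ∈ {1, …, S}` and `t ∈ {0, …, T-1}`. -/
def indices : Finset (ℕ × ℕ) := Finset.Icc 1 A.S ×ˢ Finset.range A.T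

theorem indices_nonempty (hS : 1 ≤ A.S) (hT : 1 ≤ A.T) : A.indices.Nonempty :=
  ⟨(1, 0), by simp [indices]; omega⟩

/-- Every step of the algorithm is a global minimizer of its cubic model. -/
def SolvesSubproblems : Prop :=
  ∀ p ∈ A.indices, ∀ (ω : Run d) (v : Vec d) (U : Vec d →L[ℝ] Vec d) (h : Vec d),
    cubicModel v U (A.M p.1 p.2) (A.argminRule p.1 p.2 ω v U) ≤ cubicModel v U (A.M p.1 p.2) h

/-- The gradient batch size `D_g / ‖x - r‖²`, rounded up. -/
def gradBatch (r x : Vec d) : ℕ := ⌈A.Dg / ‖x - r‖ ^ 2⌉₊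

/-- The Hessian batch size `D_h`, rounded up. -/
def hessBatch : ℕ := ⌈A.Dh⌉₊

/-- Given the gradient estimate `v` and the Hessian estimate `U` for iteration `t` of epoch `s`,
record the next iterate. -/
def advance (s t : ℕ) (ω : Run d) (v : Vec d) (U : Vec d →L[ℝ] Vec d) : Run d :=
  ω.setIter s (t + 1) (ω.iter s t + A.argminRule s t ω v U)

/-- Iteration `t` of epoch `s`. The reference point is `hat (s - 1)`. For `t = 0` the exact gradient
and Hessian of `F` are used; for `t > 0` the two batches are drawn uniformly with replacement,
independently of each other and of the past. -/
def step [NeZero n] (s t : ℕ) (ω : Run d) : PMF (Run d) :=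
  let r := ω.hat (s - 1)
  let x := ω.iter s t
  if t = 0 then
    PMF.pure (A.advance s t ω (gradient (objective A.f) r) (hessian (objective A.f) r))
  else
    (PMF.uniformOfFintype (Fin (A.gradBatch r x) → Fin n)).bind fun I =>
      (PMF.uniformOfFintype (Fin A.hessBatch → Fin n)).bind fun J =>
        PMF.pure (A.advance s t ω (semiGradient A.f r x I) (semiHessian A.f r x J))

/-- The first `t` iterations of epoch `s`, which starts from `iter s 0 = hat (s - 1)`. -/
def innerLoop [NeZero n] (s : ℕ) (ω : Run d) : ℕ → PMF (Run d)
  | 0 => PMF.pure (ω.setIter s 0 (ω.hat (s - 1)))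
  | t + 1 => (innerLoop s ω t).bind fun ω' => A.step s t ω'

/-- Epoch `s`: `T` iterations, after which `hat s = iter s T`. -/
def epoch [NeZero n] (s : ℕ) (ω : Run d) : PMF (Run d) :=
  (A.innerLoop s ω A.T).bind fun ω' => PMF.pure (ω'.setHat s (ω'.iter s A.T))

/-- The law of the points produced by the epochs `1, …, s`. -/
def run [NeZero n] : ℕ → PMF (Run d)
  | 0 => PMF.pure ⟨fun _ => A.x₀, fun _ _ => A.x₀⟩
  | s + 1 => (run s).bind fun ω => A.epoch (s + 1) ω

/-- The joint law of `(s, t)` and the output point `x_out = x_{t+1}^s`, where `(s, t)` is uniform on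
`{1, …, S} × {0, …, T-1}` and independent of the run. -/
def output [NeZero n] (hS : 1 ≤ A.S) (hT : 1 ≤ A.T) : PMF ((ℕ × ℕ) × Vec d) :=
  (A.run A.S).bind fun ω =>
    (PMF.uniformOfFinset A.indices (A.indices_nonempty hS hT)).bind fun p =>
      PMF.pure (p, ω.iter p.1 (p.2 + 1))

/-- `𝔼 μ(x_out)`, as an element of `[0, ∞]` (note `μ ≥ 0`). The penalty parameter in
`μ(x_{t+1}^s)` is `M_{s,t}`. -/
def expectedMu [NeZero n] (hS : 1 ≤ A.S) (hT : 1 ≤ A.T) : ℝ≥0∞ :=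
  ∑' o : (ℕ × ℕ) × Vec d,
    A.output hS hT o * ENNReal.ofReal (mu A.f (A.M o.1.1 o.1.2) o.2)

end Algorithm

end LiteSVRC

end

/-! With `r` the reference point of the epoch, the function `F(x) + c_{s,t} ‖x - r‖³` is a Lyapunov
function. A cubic step `h` with inexact `v`, `U` lowers `F` by `(M/12) ‖h‖³`, up to `72/√M` times
the noise `‖v - ∇F‖^{3/2} + ‖U - ∇²F‖³ / M^{3/2}` (`apply_add_le_of_cubic_step`), and `μ(x + h)` is
at most `300 (M^{3/2} ‖h‖³ + noise)` (`criterion_le_of_cubic_step`). A weighted Young inequality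
splits `‖x + h - r‖³` into multiples of `‖h‖³` and `‖x - r‖³`. The formula for `Γ` says that the
decrease `(M/12) ‖h‖³` exactly pays for `(Γ/300) μ` and for the `‖h‖³` part of the Lyapunov
function.

The mean noise is at most a multiple of `‖x - r‖³`, because the component differences are Lipschitz
in `x - r` and the gradient batch grows like `‖x - r‖⁻²` (`mean_mean_noise_le`). The recursion for
`c` absorbs this multiple. An epoch starts at `x = r` and ends with `c_{s,T} = 0`, so the decrease
telescopes over all epochs: the expected sum of `(Γ/300) μ` is at most `Δ_F`.

The probabilistic core is the third moment of the spectral norm of a centered batch mean.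
Exchangeable pairs give the recursion `E tr X^{2p+2} ≤ (2p+1) b δ² E tr X^{2p}`
(`sum_opTrace_pow_succ_le`). Iterating up to `p` of order `log d` makes the dimension cost only a
constant factor beyond `log d`. -/

noncomputable section

namespace LiteSVRC

/-! ### Exchangeable pairs for sums over a batch. -/

section BatchSum

variable {n b : ℕ}

/-- The sum of `y` over a batch of indices. -/
def batchSum {E : Type*} [AddCommGroup E] (y : Fin n → E) (J : Fin b → Fin n) : E := ∑ k, y (J k)

theorem batchSum_update {E : Type*} [AddCommGroup E] (y : Fin n → E) (J : Fin b → Fin n) (k : Fin b) (j : Fin n) :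
    batchSum y (Function.update J k j) = batchSum y J - y (J k) + y j := by
  unfold batchSum
  rw [← Finset.add_sum_erase _ _ (Finset.mem_univ k),
    ← Finset.add_sum_erase _ (fun i => y (J i)) (Finset.mem_univ k)]
  have : ∑ i ∈ Finset.univ.erase k, y (Function.update J k j i)
      = ∑ i ∈ Finset.univ.erase k, y (J i) :=
    Finset.sum_congr rfl fun i hi => by
      rw [Function.update_of_ne (Finset.ne_of_mem_erase hi)]
  rw [this]
  simp
  abel

end BatchSum

section Symmetric

variable {n b : ℕ} {E : Type*} [NormedAddCommGroup E] [InnerProductSpace ℝ E]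

theorem isSymmetric_sub {X Y : E →L[ℝ] E} (hX : (X : E →ₗ[ℝ] E).IsSymmetric)
    (hY : (Y : E →ₗ[ℝ] E).IsSymmetric) : ((X - Y : E →L[ℝ] E) : E →ₗ[ℝ] E).IsSymmetric := by
  simpa using hX.sub hY

theorem isSymmetric_batchSum {y : Fin n → E →L[ℝ] E} (hs : ∀ i, (y i : E →ₗ[ℝ] E).IsSymmetric)
    (J : Fin b → Fin n) : ((batchSum y J : E →L[ℝ] E) : E →ₗ[ℝ] E).IsSymmetric := by
  intro x z
  simp only [batchSum, ContinuousLinearMap.coe_coe, sum_apply, sum_inner,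
    inner_sum]
  exact Finset.sum_congr rfl fun k _ => hs (J k) x z

end Symmetric

section Resampling

variable {n b : ℕ} {E E' : Type*} [AddCommGroup E] [Module ℝ E] [AddCommGroup E'] [Module ℝ E']

/-- Exchanging the `k`-th index of a batch with an independent copy. -/
theorem sum_resample (k : Fin b) (G : (Fin b → Fin n) → Fin n → ℝ) :
    ∑ J, ∑ j, G (Function.update J k j) (J k) = ∑ J, ∑ j, G J j := by
  rw [← Fintype.sum_prod_type' G,
    ← Fintype.sum_prod_type' (fun J j => G (Function.update J k j) (J k))]
  have hinv : Function.Involutive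
      (fun q : (Fin b → Fin n) × Fin n => (Function.update q.1 k q.2, q.1 k)) := by
    rintro ⟨J, j⟩
    simp
  exact Equiv.sum_comp hinv.toPerm (fun q => G q.1 q.2)

/-- The method of exchangeable pairs for sums of a batch of centered vectors. -/
theorem sum_pairing_batchSum (y : Fin n → E) (hy : ∑ i, y i = 0) (B : E →ₗ[ℝ] E' →ₗ[ℝ] ℝ)
    (ψ : E → E') :
    n * ∑ J : Fin b → Fin n, B (batchSum y J) (ψ (batchSum y J)) =
      1 / 2 * ∑ k : Fin b, ∑ J : Fin b → Fin n, ∑ j,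
        B (y (J k) - y j) (ψ (batchSum y J) - ψ (batchSum y (Function.update J k j))) := by
  -- Of the four terms of the product, the two whose index does not enter the argument of `ψ` vanish
  -- by centering; the other two agree by the swap.
  have key : ∀ k : Fin b, ∑ J : Fin b → Fin n, ∑ j,
        B (y (J k) - y j) (ψ (batchSum y J) - ψ (batchSum y (Function.update J k j)))
      = 2 * ∑ J : Fin b → Fin n, n * B (y (J k)) (ψ (batchSum y J)) := by
    intro k
    have h1 : ∑ J : Fin b → Fin n, ∑ j, B (y j) (ψ (batchSum y J)) = 0 := by
      refine Finset.sum_eq_zero fun J _ => ?_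
      rw [← LinearMap.sum_apply, ← map_sum, hy]
      simp
    have h2 : ∑ J : Fin b → Fin n, ∑ j, B (y (J k)) (ψ (batchSum y (Function.update J k j)))
        = 0 := by
      rw [← h1, ← sum_resample k]
      simp
    have h3 : ∑ J : Fin b → Fin n, ∑ j, B (y j) (ψ (batchSum y (Function.update J k j)))
        = ∑ J : Fin b → Fin n, n * B (y (J k)) (ψ (batchSum y J)) := by
      rw [← sum_resample k]
      simp
    have h4 : ∑ J : Fin b → Fin n, ∑ j : Fin n, B (y (J k)) (ψ (batchSum y J))
        = ∑ J : Fin b → Fin n, n * B (y (J k)) (ψ (batchSum y J)) := by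
      simp
    simp only [map_sub, LinearMap.sub_apply, Finset.sum_sub_distrib]
    rw [h1, h2, h3, h4]
    ring
  simp_rw [key]
  rw [← Finset.mul_sum, Finset.sum_comm, Finset.mul_sum, ← mul_assoc]
  norm_num
  refine Finset.sum_congr rfl fun J _ => ?_
  rw [← Finset.mul_sum, ← LinearMap.sum_apply, ← map_sum, batchSum]

end Resampling

section GradientBatch

variable {n b : ℕ} {E : Type*} [NormedAddCommGroup E] [InnerProductSpace ℝ E]

/-- The second moment of a sum of a batch of centered vectors. -/
theorem sum_norm_sq_batchSum_le (hn : 0 < n) (y : Fin n → E) (hy : ∑ i, y i = 0) {δ : ℝ}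
    (hδ : ∀ i j, ‖y i - y j‖ ≤ δ) :
    ∑ J : Fin b → Fin n, ‖batchSum y J‖ ^ 2 ≤ (n : ℝ) ^ b * (b * δ ^ 2) := by
  have h := sum_pairing_batchSum (b := b) y hy (innerₗ E) id
  simp only [id, batchSum_update, innerₗ_apply_apply, real_inner_self_eq_norm_sq] at h
  have h1 : ∀ (k : Fin b) (J : Fin b → Fin n) (j : Fin n),
      inner ℝ (y (J k) - y j) (batchSum y J - (batchSum y J - y (J k) + y j)) ≤ δ ^ 2 := by
    intro k J j
    rw [show batchSum y J - (batchSum y J - y (J k) + y j) = y (J k) - y j by abel,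
      real_inner_self_eq_norm_sq]
    exact pow_le_pow_left₀ (norm_nonneg _) (hδ _ _) 2
  have h2 := Finset.sum_le_sum fun k (_ : k ∈ (Finset.univ : Finset (Fin b))) =>
    Finset.sum_le_sum fun J (_ : J ∈ (Finset.univ : Finset (Fin b → Fin n))) =>
      Finset.sum_le_sum fun j (_ : j ∈ (Finset.univ : Finset (Fin n))) => h1 k J j
  simp only [Finset.sum_const, Finset.card_univ, Fintype.card_fin, Fintype.card_fun,
    nsmul_eq_mul, Nat.cast_pow] at h2
  have hn' : (0 : ℝ) < n := by exact_mod_cast hn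
  -- The pairing identity carries a factor 1/2, which is given away here.
  have h3 : 0 ≤ (b : ℝ) * (n ^ b * (n * δ ^ 2)) := by positivity
  refine le_of_mul_le_mul_left ?_ hn'
  rw [h]
  nlinarith

end GradientBatch

/-! ### Trace moments of random symmetric operators. -/

section Trace

variable {E : Type*} [NormedAddCommGroup E] [InnerProductSpace ℝ E] [FiniteDimensional ℝ E]

/-- The trace of a continuous linear operator. -/
def opTrace (E : Type*) [NormedAddCommGroup E] [InnerProductSpace ℝ E] [FiniteDimensional ℝ E] :
    (E →L[ℝ] E) →ₗ[ℝ] ℝ :=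
  LinearMap.trace ℝ E ∘ₗ ContinuousLinearMap.coeLM ℝ

theorem opTrace_eq_sum_inner {ι : Type*} [Fintype ι] (T : E →L[ℝ] E) (e : OrthonormalBasis ι ℝ E) :
    opTrace E T = ∑ i, inner ℝ (e i) (T (e i)) := by
  simp [opTrace, LinearMap.trace_eq_sum_inner _ e]

/-- An orthonormal eigenbasis of a symmetric operator. -/
theorem exists_eigenbasis (X : E →L[ℝ] E) (hX : (X : E →ₗ[ℝ] E).IsSymmetric) :
    ∃ (e : OrthonormalBasis (Fin (Module.finrank ℝ E)) ℝ E)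
      (w : Fin (Module.finrank ℝ E) → ℝ), ∀ k i, (X ^ k) (e i) = w i ^ k • e i := by
  refine ⟨hX.eigenvectorBasis rfl, hX.eigenvalues rfl, fun k i => ?_⟩
  have h1 : X (hX.eigenvectorBasis rfl i) = hX.eigenvalues rfl i • hX.eigenvectorBasis rfl i :=
    hX.apply_eigenvectorBasis rfl i
  induction k with
  | zero => simp
  | succ k ih =>
    rw [pow_succ, mul_apply_eq_comp, h1, map_smul, ih, smul_smul, pow_succ, mul_comm]

theorem opTrace_pow {ι : Type*} [Fintype ι] {X : E →L[ℝ] E} {e : OrthonormalBasis ι ℝ E}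
    {w : ι → ℝ} (h : ∀ k i, (X ^ k) (e i) = w i ^ k • e i) (k : ℕ) :
    opTrace E (X ^ k) = ∑ i, w i ^ k := by
  rw [opTrace_eq_sum_inner _ e]
  refine Finset.sum_congr rfl fun i _ => ?_
  rw [h, inner_smul_right, real_inner_self_eq_norm_sq, e.norm_eq_one]
  simp

/-- Both factors are bounded by powers of the larger of `|u|` and `|v|`. -/
theorem abs_pow_mul_pow_le (u v : ℝ) {q s r : ℕ} (h : q + s = 2 * r) :
    |u ^ q * v ^ s| ≤ u ^ (2 * r) + v ^ (2 * r) := by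
  have hu : u ^ (2 * r) = |u| ^ (2 * r) := by rw [pow_mul, pow_mul, sq_abs]
  have hv : v ^ (2 * r) = |v| ^ (2 * r) := by rw [pow_mul, pow_mul, sq_abs]
  rw [abs_mul, abs_pow, abs_pow, hu, hv, ← h]
  rcases le_total |u| |v| with h' | h'
  · calc |u| ^ q * |v| ^ s ≤ |v| ^ q * |v| ^ s := by gcongr
      _ = |v| ^ (q + s) := (pow_add _ _ _).symm
      _ ≤ _ := le_add_of_nonneg_left (by positivity)
  · calc |u| ^ q * |v| ^ s ≤ |u| ^ q * |u| ^ s := by gcongr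
      _ = |u| ^ (q + s) := (pow_add _ _ _).symm
      _ ≤ _ := le_add_of_nonneg_right (by positivity)

/-- A trace inequality for interlaced powers of two symmetric operators. -/
theorem abs_opTrace_interlaced_le {D W Y : E →L[ℝ] E} (hD : (D : E →ₗ[ℝ] E).IsSymmetric)
    (hW : (W : E →ₗ[ℝ] E).IsSymmetric) (hY : (Y : E →ₗ[ℝ] E).IsSymmetric)
    {δ : ℝ} (hδ : ‖D‖ ≤ δ) {q s r : ℕ} (h : q + s = 2 * r) :
    |opTrace E (D * (W ^ q * D * Y ^ s))| ≤
      δ ^ 2 * (opTrace E (W ^ (2 * r)) + opTrace E (Y ^ (2 * r))) := by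
  obtain ⟨e, w, he⟩ := exists_eigenbasis W hW
  obtain ⟨g, z, hg⟩ := exists_eigenbasis Y hY
  have hD' : ∀ x y, inner ℝ (D x) y = inner ℝ x (D y) := hD
  have hWq : ∀ i x, inner ℝ (e i) ((W ^ q) x) = w i ^ q * inner ℝ (e i) x := by
    intro i x
    have : ((W ^ q : E →L[ℝ] E) : E →ₗ[ℝ] E).IsSymmetric := by
      have := hW.pow q
      rwa [← ContinuousLinearMap.toLinearMap_pow] at this
    have h2 : inner ℝ ((W ^ q) (e i)) x = inner ℝ (e i) ((W ^ q) x) := this _ _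
    rw [← h2, he, inner_smul_left]
    simp
  -- In eigenbases of `W` and `Y` the trace becomes a sum with nonnegative weights `⟨e i, D (g
  -- j)⟩²`, so a scalar inequality between eigenvalues suffices. The weights in each row and each
  -- column sum to at most `δ²`.
  have h1 : opTrace E (D * (W ^ q * D * Y ^ s)) =
      ∑ j, ∑ i, w i ^ q * z j ^ s * inner ℝ (e i) (D (g j)) ^ 2 := by
    rw [opTrace_eq_sum_inner _ g]
    refine Finset.sum_congr rfl fun j _ => ?_
    simp only [mul_apply_eq_comp, hg, map_smul, inner_smul_right]
    rw [← hD', ← e.sum_inner_mul_inner, Finset.mul_sum]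
    refine Finset.sum_congr rfl fun i _ => ?_
    rw [hWq, real_inner_comm]
    ring
  have hn1 : ∀ j, ∑ i, inner ℝ (e i) (D (g j)) ^ 2 ≤ δ ^ 2 := by
    intro j
    have := e.sum_sq_norm_inner_right (D (g j))
    simp only [Real.norm_eq_abs, sq_abs] at this
    rw [this]
    refine pow_le_pow_left₀ (norm_nonneg _) ?_ 2
    calc ‖D (g j)‖ ≤ ‖D‖ * ‖g j‖ := D.le_opNorm _
      _ ≤ δ := by rw [g.norm_eq_one, mul_one]; exact hδ
  have hn2 : ∀ i, ∑ j, inner ℝ (e i) (D (g j)) ^ 2 ≤ δ ^ 2 := by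
    intro i
    have := g.sum_sq_norm_inner_left (D (e i))
    simp only [Real.norm_eq_abs, sq_abs, hD'] at this
    rw [this]
    refine pow_le_pow_left₀ (norm_nonneg _) ?_ 2
    calc ‖D (e i)‖ ≤ ‖D‖ * ‖e i‖ := D.le_opNorm _
      _ ≤ δ := by rw [e.norm_eq_one, mul_one]; exact hδ
  rw [h1, opTrace_pow he, opTrace_pow hg]
  calc |∑ j, ∑ i, w i ^ q * z j ^ s * inner ℝ (e i) (D (g j)) ^ 2|
      ≤ ∑ j, ∑ i, (w i ^ (2 * r) + z j ^ (2 * r)) * inner ℝ (e i) (D (g j)) ^ 2 := by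
        refine (Finset.abs_sum_le_sum_abs _ _).trans (Finset.sum_le_sum fun j _ => ?_)
        refine (Finset.abs_sum_le_sum_abs _ _).trans (Finset.sum_le_sum fun i _ => ?_)
        rw [abs_mul, abs_of_nonneg (sq_nonneg (inner ℝ (e i) (D (g j))))]
        exact mul_le_mul_of_nonneg_right (abs_pow_mul_pow_le _ _ h) (sq_nonneg _)
    _ = ∑ i, w i ^ (2 * r) * ∑ j, inner ℝ (e i) (D (g j)) ^ 2
        + ∑ j, z j ^ (2 * r) * ∑ i, inner ℝ (e i) (D (g j)) ^ 2 := by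
        simp only [add_mul, Finset.sum_add_distrib, Finset.mul_sum]
        rw [Finset.sum_comm]
    _ ≤ ∑ i, w i ^ (2 * r) * δ ^ 2 + ∑ j, z j ^ (2 * r) * δ ^ 2 := by
        refine add_le_add (Finset.sum_le_sum fun i _ => ?_) (Finset.sum_le_sum fun j _ => ?_)
        · exact mul_le_mul_of_nonneg_left (hn2 i) (Even.pow_nonneg (even_two_mul r) _)
        · exact mul_le_mul_of_nonneg_left (hn1 j) (Even.pow_nonneg (even_two_mul r) _)
    _ = _ := by rw [← Finset.sum_mul, ← Finset.sum_mul]; ring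

/-- The trace of an even power is a sum of nonnegative terms, among them the `2p`-th power of the
largest `|eigenvalue|`. -/
theorem norm_pow_le_opTrace {X : E →L[ℝ] E} (hX : (X : E →ₗ[ℝ] E).IsSymmetric) {p : ℕ}
    (hp : p ≠ 0) : ‖X‖ ^ (2 * p) ≤ opTrace E (X ^ (2 * p)) := by
  obtain ⟨e, w, he⟩ := exists_eigenbasis X hX
  have hX' : ∀ x y, inner ℝ (X x) y = inner ℝ x (X y) := hX
  have hnn : ∀ i, 0 ≤ w i ^ (2 * p) := fun i => Even.pow_nonneg (even_two_mul p) _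
  have ht : 0 ≤ opTrace E (X ^ (2 * p)) := by
    rw [opTrace_pow he]; exact Finset.sum_nonneg fun i _ => hnn i
  set τ := opTrace E (X ^ (2 * p)) with hτ
  have hp' : (0 : ℝ) < 2 * p := by positivity
  set κ : ℝ := τ ^ (1 / (2 * p : ℝ))
  have hκ : 0 ≤ κ := by positivity
  have hκp : κ ^ (2 * p) = τ := by
    rw [← Real.rpow_natCast, ← Real.rpow_mul ht]
    push_cast
    rw [one_div_mul_cancel hp'.ne', Real.rpow_one]
  have hw : ∀ i, |w i| ≤ κ := by
    intro i
    refine le_of_pow_le_pow_left₀ (n := 2 * p) (by omega) hκ ?_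
    rw [hκp, hτ, opTrace_pow he, ← abs_pow, abs_of_nonneg (hnn i)]
    exact Finset.single_le_sum (f := fun i => w i ^ (2 * p)) (fun i _ => hnn i) (Finset.mem_univ i)
  rw [← hκp]
  refine pow_le_pow_left₀ (norm_nonneg _) (X.opNorm_le_bound hκ fun x => ?_) _
  refine le_of_pow_le_pow_left₀ (n := 2) two_ne_zero (by positivity) ?_
  rw [mul_pow, ← e.sum_sq_norm_inner_right (X x), ← e.sum_sq_norm_inner_right x, Finset.mul_sum]
  refine Finset.sum_le_sum fun i _ => ?_
  have h1 : X (e i) = w i • e i := by simpa using he 1 i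
  rw [← hX', h1, inner_smul_left, norm_mul, mul_pow]
  refine mul_le_mul_of_nonneg_right ?_ (by positivity)
  exact pow_le_pow_left₀ (norm_nonneg _) (by simpa using hw i) 2

/-- Noncommutative telescoping: each summand has the interlaced shape of
`abs_opTrace_interlaced_le`. -/
theorem pow_sub_pow_eq_sum {R : Type*} [Ring R] (X Y : R) (m : ℕ) :
    X ^ m - Y ^ m = ∑ q ∈ Finset.range m, X ^ q * (X - Y) * Y ^ (m - 1 - q) := by
  induction m with
  | zero => simp
  | succ m ih =>
    rw [Finset.sum_range_succ]
    have : ∑ q ∈ Finset.range m, X ^ q * (X - Y) * Y ^ (m + 1 - 1 - q) = (X ^ m - Y ^ m) * Y := by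
      rw [ih, Finset.sum_mul]
      refine Finset.sum_congr rfl fun q hq => ?_
      have := Finset.mem_range.1 hq
      rw [show m + 1 - 1 - q = (m - 1 - q) + 1 by omega, pow_succ]
      simp only [mul_assoc]
    rw [this]
    simp [pow_succ]
    noncomm_ring

/-- The bilinear form `tr (S T)`. -/
def tracePairing (E : Type*) [NormedAddCommGroup E] [InnerProductSpace ℝ E]
    [FiniteDimensional ℝ E] : (E →L[ℝ] E) →ₗ[ℝ] (E →L[ℝ] E) →ₗ[ℝ] ℝ :=
  LinearMap.mk₂ ℝ (fun S T => opTrace E (S * T))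
    (fun _ _ _ => by rw [add_mul, map_add]) (fun _ _ _ => by rw [smul_mul_assoc, map_smul])
    (fun _ _ _ => by rw [mul_add, map_add]) (fun _ _ _ => by rw [mul_smul_comm, map_smul])

theorem tracePairing_apply (S T : E →L[ℝ] E) : tracePairing E S T = opTrace E (S * T) := rfl

variable {n b : ℕ}

/-- Recursion for the trace moments of a sum of a batch of centered symmetric operators. -/
theorem sum_opTrace_pow_succ_le (hn : 0 < n) {y : Fin n → E →L[ℝ] E}
    (hs : ∀ i, (y i : E →ₗ[ℝ] E).IsSymmetric) (hy : ∑ i, y i = 0) {δ : ℝ}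
    (hδ : ∀ i j, ‖y i - y j‖ ≤ δ) (p : ℕ) :
    ∑ J : Fin b → Fin n, opTrace E (batchSum y J ^ (2 * (p + 1))) ≤
      (2 * p + 1) * b * δ ^ 2 * ∑ J : Fin b → Fin n, opTrace E (batchSum y J ^ (2 * p)) := by
  have h := sum_pairing_batchSum (b := b) y hy (tracePairing E) (fun X => X ^ (2 * p + 1))
  simp only [tracePairing_apply, ← pow_succ'] at h
  have hterm : ∀ (k : Fin b) (J : Fin b → Fin n) (j : Fin n),
      opTrace E ((y (J k) - y j) * (batchSum y J ^ (2 * p + 1)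
        - batchSum y (Function.update J k j) ^ (2 * p + 1))) ≤
      (2 * p + 1) * (δ ^ 2 * (opTrace E (batchSum y J ^ (2 * p))
        + opTrace E (batchSum y (Function.update J k j) ^ (2 * p)))) := by
    intro k J j
    -- The odd power `2p + 1` leaves exponents with even total `2p` around the middle factor, so
    -- only traces of even powers appear.
    rw [pow_sub_pow_eq_sum, Finset.mul_sum, map_sum]
    have hd : batchSum y J - batchSum y (Function.update J k j) = y (J k) - y j := by
      rw [batchSum_update]; abel
    rw [hd]
    have := Finset.sum_le_card_nsmul (Finset.range (2 * p + 1))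
      (fun q => opTrace E ((y (J k) - y j) * (batchSum y J ^ q * (y (J k) - y j)
        * batchSum y (Function.update J k j) ^ (2 * p + 1 - 1 - q))))
      (δ ^ 2 * (opTrace E (batchSum y J ^ (2 * p))
        + opTrace E (batchSum y (Function.update J k j) ^ (2 * p)))) (fun q hq => by
        have hq' := Finset.mem_range.1 hq
        exact (le_abs_self _).trans (abs_opTrace_interlaced_le
          (isSymmetric_sub (hs _) (hs _)) (isSymmetric_batchSum hs _) (isSymmetric_batchSum hs _)
          (hδ _ _) (by omega)))
    refine this.trans (le_of_eq ?_)
    simp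
  have h2 := Finset.sum_le_sum fun k (_ : k ∈ (Finset.univ : Finset (Fin b))) =>
    Finset.sum_le_sum fun J (_ : J ∈ (Finset.univ : Finset (Fin b → Fin n))) =>
      Finset.sum_le_sum fun j (_ : j ∈ (Finset.univ : Finset (Fin n))) => hterm k J j
  have h3 : ∀ k : Fin b, ∑ J : Fin b → Fin n, ∑ j : Fin n,
      opTrace E (batchSum y (Function.update J k j) ^ (2 * p))
      = n * ∑ J : Fin b → Fin n, opTrace E (batchSum y J ^ (2 * p)) := by
    intro k
    rw [sum_resample k (fun J _ => opTrace E (batchSum y J ^ (2 * p)))]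
    simp [Finset.mul_sum]
  simp only [← Finset.mul_sum, Finset.sum_add_distrib, h3] at h2
  simp only [Finset.sum_const, Finset.card_univ, Fintype.card_fin, nsmul_eq_mul,
    ← Finset.mul_sum] at h2
  have hn' : (0 : ℝ) < n := by exact_mod_cast hn
  refine le_of_mul_le_mul_left ?_ hn'
  rw [show 2 * (p + 1) = 2 * p + 1 + 1 by ring, h]
  linarith

/-- The recursion is iterated down to the trace of the identity, which is the dimension; every
factor `2q + 1` with `q < p` is replaced by `2p`. -/
theorem sum_opTrace_pow_le (hn : 0 < n) {y : Fin n → E →L[ℝ] E}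
    (hs : ∀ i, (y i : E →ₗ[ℝ] E).IsSymmetric) (hy : ∑ i, y i = 0) {δ : ℝ}
    (hδ : ∀ i j, ‖y i - y j‖ ≤ δ) (p : ℕ) :
    ∑ J : Fin b → Fin n, opTrace E (batchSum y J ^ (2 * p)) ≤
      (n : ℝ) ^ b * ((2 * p * b * δ ^ 2) ^ p * Module.finrank ℝ E) := by
  suffices H : ∀ q ≤ p, ∑ J : Fin b → Fin n, opTrace E (batchSum y J ^ (2 * q)) ≤
      (n : ℝ) ^ b * ((2 * p * b * δ ^ 2) ^ q * Module.finrank ℝ E) from H p le_rfl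
  intro q hq
  induction q with
  | zero =>
    simp only [mul_zero, pow_zero, one_mul]
    have : opTrace E 1 = Module.finrank ℝ E := LinearMap.trace_one ℝ E
    simp [this]
  | succ q ih =>
    refine (sum_opTrace_pow_succ_le hn hs hy hδ q).trans ?_
    have hqp : (2 * q + 1 : ℝ) ≤ 2 * p := by
      have : (q : ℝ) + 1 ≤ p := by exact_mod_cast hq
      linarith
    calc (2 * q + 1) * b * δ ^ 2 * ∑ J : Fin b → Fin n, opTrace E (batchSum y J ^ (2 * q))
        ≤ (2 * q + 1) * b * δ ^ 2 * ((n : ℝ) ^ b * ((2 * p * b * δ ^ 2) ^ q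
          * Module.finrank ℝ E)) := by
          gcongr
          exact ih (by omega)
      _ ≤ 2 * p * b * δ ^ 2 * ((n : ℝ) ^ b * ((2 * p * b * δ ^ 2) ^ q
          * Module.finrank ℝ E)) := by gcongr
      _ = _ := by ring

end Trace

/-! ### Moments of batch means. -/

section Moments

/-- Power means of a finite family: `mean (a ^ r) ≤ (mean (a ^ m)) ^ (r / m)` for `0 < r ≤ m`. -/
theorem mean_rpow_le {ι : Type*} [Fintype ι] [Nonempty ι] (a : ι → ℝ) (ha : ∀ i, 0 ≤ a i)
    {r : ℝ} {m : ℕ} (hr : 0 < r) (hrm : r ≤ m) :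
    (Fintype.card ι : ℝ)⁻¹ * ∑ i, a i ^ r ≤
      ((Fintype.card ι : ℝ)⁻¹ * ∑ i, a i ^ m) ^ (r / m) := by
  have hm : (0 : ℝ) < m := hr.trans_le hrm
  have h := Real.arith_mean_le_rpow_mean Finset.univ (fun _ : ι => (Fintype.card ι : ℝ)⁻¹)
    (fun i => a i ^ r) (fun _ _ => by positivity)
    (by simp) (fun i _ => Real.rpow_nonneg (ha i) _) (p := m / r) ((one_le_div hr).2 hrm)
  rw [← Finset.mul_sum, ← Finset.mul_sum, one_div_div] at h
  refine h.trans (le_of_eq ?_)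
  congr 2
  refine Finset.sum_congr rfl fun i _ => ?_
  rw [← Real.rpow_mul (ha i), mul_div_cancel₀ _ hr.ne', Real.rpow_natCast]

variable {n b : ℕ} {E : Type*} [NormedAddCommGroup E] [InnerProductSpace ℝ E]

/-- The `3/2`-th moment of the mean of a batch of centered vectors. -/
theorem mean_norm_rpow_batchMean_le (hn : 0 < n) (hb : 0 < b) (y : Fin n → E)
    (hy : ∑ i, y i = 0) {δ : ℝ} (hδ : ∀ i j, ‖y i - y j‖ ≤ δ) :
    ((n : ℝ) ^ b)⁻¹ * ∑ J : Fin b → Fin n, ‖(1 / (b : ℝ)) • batchSum y J‖ ^ (3 / 2 : ℝ) ≤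
      (δ ^ 2 / b) ^ (3 / 4 : ℝ) := by
  have : Nonempty (Fin b → Fin n) := ⟨fun _ => ⟨0, hn⟩⟩
  have hn' : (0 : ℝ) < n := by exact_mod_cast hn
  have hb' : (0 : ℝ) < b := by exact_mod_cast hb
  have h := mean_rpow_le (fun J : Fin b → Fin n => ‖(1 / (b : ℝ)) • batchSum y J‖)
    (fun _ => norm_nonneg _) (r := 3 / 2) (m := 2) (by norm_num) (by norm_num)
  simp only [Fintype.card_fun, Fintype.card_fin, Nat.cast_pow] at h
  refine h.trans ?_
  rw [show (3 / 2 / ((2 : ℕ) : ℝ)) = (3 / 4 : ℝ) by norm_num]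
  refine Real.rpow_le_rpow (by positivity) ?_ (by norm_num)
  have h2 := sum_norm_sq_batchSum_le (b := b) hn y hy hδ
  simp only [norm_smul, mul_pow, ← Finset.mul_sum]
  rw [inv_mul_le_iff₀ (by positivity)]
  calc ‖(1 / (b : ℝ))‖ ^ 2 * ∑ J : Fin b → Fin n, ‖batchSum y J‖ ^ 2
      ≤ ‖(1 / (b : ℝ))‖ ^ 2 * ((n : ℝ) ^ b * (b * δ ^ 2)) := by gcongr
    _ = _ := by
      rw [Real.norm_of_nonneg (by positivity)]
      field_simp

variable [FiniteDimensional ℝ E]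

/-- The third moment of the operator norm of the mean of a batch of centered symmetric operators. -/
theorem mean_norm_pow_three_batchMean_le (hn : 0 < n) (hb : 0 < b) (hd : 2 ≤ Module.finrank ℝ E)
    (y : Fin n → E →L[ℝ] E) (hs : ∀ i, (y i : E →ₗ[ℝ] E).IsSymmetric) (hy : ∑ i, y i = 0)
    {δ : ℝ} (hδ : ∀ i j, ‖y i - y j‖ ≤ δ) :
    ((n : ℝ) ^ b)⁻¹ * ∑ J : Fin b → Fin n, ‖(1 / (b : ℝ)) • batchSum y J‖ ^ 3 ≤
      (25 * Real.log (Module.finrank ℝ E) * δ ^ 2 / b) ^ (3 / 2 : ℝ) := by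
  have : Nonempty (Fin b → Fin n) := ⟨fun _ => ⟨0, hn⟩⟩
  have hn' : (0 : ℝ) < n := by exact_mod_cast hn
  have hb' : (0 : ℝ) < b := by exact_mod_cast hb
  set d : ℕ := Module.finrank ℝ E
  have hd' : (2 : ℝ) ≤ d := by exact_mod_cast hd
  set l := Real.log d with hl
  have hl2 : 0.69 < l := by
    have := Real.log_two_gt_d9
    have h2 : Real.log 2 ≤ l := Real.log_le_log (by norm_num) hd'
    linarith
  -- From `p ≥ log d` follows `d^{3/(2p)} ≤ e^{3/2}`; from `p ≥ 2`, that the power mean of order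
  -- `2p` dominates the one of order 3; and `2p ≤ 8 log d` because `log d > 0.69`.
  set p : ℕ := ⌈l⌉₊ + 1
  have hpl : l ≤ p := by
    have := Nat.le_ceil l
    push_cast [p]; linarith
  have hp2 : (2 : ℝ) ≤ p := by
    have : 0 < ⌈l⌉₊ := Nat.ceil_pos.2 (by linarith)
    have : 2 ≤ p := by omega
    exact_mod_cast this
  have hpu : 2 * (p : ℝ) ≤ 8 * l := by
    have := Nat.ceil_lt_add_one (a := l) (by linarith)
    push_cast [p]; linarith
  have hp0 : p ≠ 0 := by omega
  have h := mean_rpow_le (fun J : Fin b → Fin n => ‖(1 / (b : ℝ)) • batchSum y J‖)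
    (fun _ => norm_nonneg _) (r := 3) (m := 2 * p) (by norm_num) (by push_cast; linarith)
  simp only [Fintype.card_fun, Fintype.card_fin, Nat.cast_pow] at h
  have hconv : ∀ J : Fin b → Fin n, ‖(1 / (b : ℝ)) • batchSum y J‖ ^ 3
      = ‖(1 / (b : ℝ)) • batchSum y J‖ ^ (3 : ℝ) := fun J => by
    rw [← Real.rpow_natCast]; norm_num
  simp only [hconv]
  refine h.trans ?_
  have h2 := sum_opTrace_pow_le (b := b) hn hs hy hδ p
  have h3 : ((n : ℝ) ^ b)⁻¹ * ∑ J : Fin b → Fin n, ‖(1 / (b : ℝ)) • batchSum y J‖ ^ (2 * p)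
      ≤ (2 * p * δ ^ 2 / b) ^ p * d := by
    simp only [norm_smul, mul_pow, ← Finset.mul_sum]
    rw [inv_mul_le_iff₀ (by positivity)]
    calc ‖(1 / (b : ℝ))‖ ^ (2 * p) * ∑ J : Fin b → Fin n, ‖batchSum y J‖ ^ (2 * p)
        ≤ ‖(1 / (b : ℝ))‖ ^ (2 * p) * ((n : ℝ) ^ b * ((2 * p * b * δ ^ 2) ^ p * d)) := by
          refine mul_le_mul_of_nonneg_left (le_trans ?_ h2) (by positivity)
          exact Finset.sum_le_sum fun J _ => norm_pow_le_opTrace (isSymmetric_batchSum hs J) hp0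
      _ = _ := by
        rw [Real.norm_of_nonneg (by positivity), pow_mul, one_div, inv_pow]
        rw [show 2 * (p : ℝ) * b * δ ^ 2 = b ^ 2 * (2 * p * δ ^ 2 / b) by field_simp, mul_pow,
          inv_pow]
        field_simp
  have hp0' : (p : ℝ) ≠ 0 := by positivity
  have h4 : ((2 * p * δ ^ 2 / b) ^ p * (d : ℝ)) ^ ((3 : ℝ) / (2 * p : ℕ))
      = (2 * p * δ ^ 2 / b) ^ (3 / 2 : ℝ) * Real.exp (3 / 2 * (l / p)) := by
    rw [Real.mul_rpow (by positivity) (by positivity), ← Real.rpow_natCast,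
      ← Real.rpow_mul (by positivity)]
    congr 1
    · congr 1
      push_cast
      field_simp
    · rw [Real.rpow_def_of_pos (by linarith)]
      congr 1
      push_cast
      rw [← hl]
      field_simp
  refine (Real.rpow_le_rpow (by positivity) h3 (by positivity)).trans ?_
  rw [h4]
  have h5 : Real.exp (3 / 2 * (l / p)) ≤ Real.exp 1 ^ (3 / 2 : ℝ) := by
    rw [← Real.exp_mul]
    refine Real.exp_le_exp.2 ?_
    have : l / p ≤ 1 := (div_le_one (by positivity)).2 hpl
    linarith
  calc (2 * p * δ ^ 2 / b) ^ (3 / 2 : ℝ) * Real.exp (3 / 2 * (l / p))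
      ≤ (2 * p * δ ^ 2 / b) ^ (3 / 2 : ℝ) * Real.exp 1 ^ (3 / 2 : ℝ) := by gcongr
    _ = (2 * p * δ ^ 2 / b * Real.exp 1) ^ (3 / 2 : ℝ) :=
      (Real.mul_rpow (by positivity) (by positivity)).symm
    _ ≤ _ := by
      refine Real.rpow_le_rpow (by positivity) ?_ (by norm_num)
      rw [div_mul_eq_mul_div]
      refine div_le_div_of_nonneg_right ?_ hb'.le
      have he := Real.exp_one_lt_d9
      -- The constant 25 comes from `8e < 25`.
      have : 2 * (p : ℝ) * Real.exp 1 ≤ 25 * l := by nlinarith [Real.exp_pos 1]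
      nlinarith [sq_nonneg δ]

end Moments

/-! ### Gradients, Hessians and Taylor estimates with Lipschitz Hessian. -/

section Calculus

variable {E : Type*} [NormedAddCommGroup E] [InnerProductSpace ℝ E] [CompleteSpace E] {F : E → ℝ}

/-- The Hessian of a function on a Hilbert space, as the derivative of the gradient. -/
def hess (F : E → ℝ) (x : E) : E →L[ℝ] E := fderiv ℝ (gradient F) x

theorem hasGradientAt_of_contDiff (hF : ContDiff ℝ 2 F) (x : E) :
    HasGradientAt F (gradient F x) x :=
  (hF.differentiable two_ne_zero x).hasGradientAt

theorem hasFDerivAt_gradient (hF : ContDiff ℝ 2 F) (x : E) :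
    HasFDerivAt (gradient F) (hess F x) x := by
  refine DifferentiableAt.hasFDerivAt ?_
  have h1 : ContDiff ℝ 1 (fderiv ℝ F) := hF.fderiv_right (by norm_num)
  exact (InnerProductSpace.toDual ℝ E).symm.toContinuousLinearEquiv.differentiable.comp
    (h1.differentiable one_ne_zero) x

/-- Differentiating `⟨∇F, z⟩` in two ways carries the symmetry of the second derivative over to
`hess`. -/
theorem inner_hess (hF : ContDiff ℝ 2 F) (x y z : E) :
    inner ℝ (hess F x y) z = fderiv ℝ (fderiv ℝ F) x y z := by
  have h1 : ContDiff ℝ 1 (fderiv ℝ F) := hF.fderiv_right (by norm_num)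
  have h2 := (h1.differentiable one_ne_zero x).hasFDerivAt.clm_apply (hasFDerivAt_const z x)
  have h3 := (hasFDerivAt_gradient hF x).inner ℝ (hasFDerivAt_const z x)
  simp only [inner_gradient_left] at h3
  have := congrArg (fun T : E →L[ℝ] ℝ => T y) (h3.unique h2)
  simpa using this

theorem isSymmetric_hess (hF : ContDiff ℝ 2 F) (x : E) :
    (hess F x : E →ₗ[ℝ] E).IsSymmetric := by
  intro y z
  have h : IsSymmSndFDerivAt ℝ F x := hF.contDiffAt.isSymmSndFDerivAt (by simp)
  simp only [ContinuousLinearMap.coe_coe]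
  rw [inner_hess hF, ← real_inner_comm, inner_hess hF]
  exact h _ _

end Calculus

section Taylor

variable {E : Type*} [NormedAddCommGroup E] [InnerProductSpace ℝ E] [CompleteSpace E] {F : E → ℝ}
  {L : ℝ}

/-- A comparison of derivatives in `τ` replaces the integral remainder. The parameter `τ` is kept
because `apply_add_le_cubic` needs the bound along the whole segment. -/
theorem norm_gradient_add_smul_sub_le (hF : ContDiff ℝ 2 F)
    (hL : ∀ x y, ‖hess F x - hess F y‖ ≤ L * ‖x - y‖) (x h : E) {τ : ℝ} (hτ : 0 ≤ τ) :
    ‖gradient F (x + τ • h) - gradient F x - τ • hess F x h‖ ≤ L * ‖h‖ ^ 2 / 2 * τ ^ 2 := by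
  have hline : ∀ t : ℝ, HasDerivAt (fun t : ℝ => x + t • h) h t := fun t => by
    simpa using ((hasDerivAt_id t).smul_const h).const_add x
  have hd : ∀ t : ℝ, HasDerivAt (fun t : ℝ => gradient F (x + t • h) - gradient F x
      - t • hess F x h) (hess F (x + t • h) h - hess F x h) t := fun t => by
    have h1 := (hasFDerivAt_gradient hF (x + t • h)).comp_hasDerivAt t (hline t)
    have h2 := (hasDerivAt_id t).smul_const (hess F x h)
    rw [one_smul] at h2
    exact (h1.sub_const (gradient F x)).sub h2
  have hB : ∀ t : ℝ, HasDerivAt (fun t : ℝ => L * ‖h‖ ^ 2 / 2 * t ^ 2) (L * ‖h‖ ^ 2 * t) t :=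
    fun t => ((hasDerivAt_pow 2 t).const_mul (L * ‖h‖ ^ 2 / 2)).congr_deriv (by norm_num; ring)
  refine image_norm_le_of_norm_deriv_right_le_deriv_boundary (a := 0) (b := τ)
    (fun t _ => (hd t).continuousAt.continuousWithinAt) (fun t _ => (hd t).hasDerivWithinAt)
    (by simp) (fun t => hB t) (fun t ht => ?_) ⟨hτ, le_rfl⟩
  calc ‖hess F (x + t • h) h - hess F x h‖
      ≤ ‖hess F (x + t • h) - hess F x‖ * ‖h‖ :=
        (hess F (x + t • h) - hess F x).le_opNorm h
    _ ≤ L * ‖x + t • h - x‖ * ‖h‖ := by gcongr; exact hL _ _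
    _ = L * ‖h‖ ^ 2 * t := by
      rw [add_sub_cancel_left, norm_smul, Real.norm_of_nonneg ht.1]; ring

theorem norm_gradient_add_sub_le (hF : ContDiff ℝ 2 F)
    (hL : ∀ x y, ‖hess F x - hess F y‖ ≤ L * ‖x - y‖) (x h : E) :
    ‖gradient F (x + h) - gradient F x - hess F x h‖ ≤ L * ‖h‖ ^ 2 / 2 := by
  simpa using norm_gradient_add_smul_sub_le hF hL x h zero_le_one

theorem apply_add_le_cubic (hF : ContDiff ℝ 2 F)
    (hL : ∀ x y, ‖hess F x - hess F y‖ ≤ L * ‖x - y‖) (x h : E) :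
    F (x + h) ≤ F x + inner ℝ (gradient F x) h + 1 / 2 * inner ℝ (hess F x h) h
      + L / 6 * ‖h‖ ^ 3 := by
  have hline : ∀ t : ℝ, HasDerivAt (fun t : ℝ => x + t • h) h t := fun t => by
    simpa using ((hasDerivAt_id t).smul_const h).const_add x
  set g := gradient F x with hg
  set H := hess F x h with hH
  have hd : ∀ t : ℝ, HasDerivAt (fun t : ℝ => F (x + t • h) - F x - t * inner ℝ g h
      - t ^ 2 * (1 / 2 * inner ℝ H h)) (inner ℝ (gradient F (x + t • h) - g - t • H) h) t :=
    fun t => by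
      have h1 : HasDerivAt (fun t : ℝ => F (x + t • h)) (inner ℝ (gradient F (x + t • h)) h) t :=
        ((hasGradientAt_of_contDiff hF (x + t • h)).hasFDerivAt.comp_hasDerivAt t
          (hline t)).congr_deriv (by simp)
      have h2 := (hasDerivAt_id t).mul_const (inner ℝ g h)
      have h3 := (hasDerivAt_pow 2 t).mul_const (1 / 2 * inner ℝ H h)
      refine (((h1.sub_const (F x)).sub h2).sub h3).congr_deriv ?_
      simp only [inner_sub_left, inner_smul_left]
      norm_num
      ring
  have hB : ∀ t : ℝ, HasDerivAt (fun t : ℝ => L * ‖h‖ ^ 3 / 6 * t ^ 3)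
      (L * ‖h‖ ^ 3 / 2 * t ^ 2) t := fun t =>
    ((hasDerivAt_pow 3 t).const_mul (L * ‖h‖ ^ 3 / 6)).congr_deriv (by norm_num; ring)
  have key := image_norm_le_of_norm_deriv_right_le_deriv_boundary (a := 0) (b := 1)
    (fun t _ => (hd t).continuousAt.continuousWithinAt) (fun t _ => (hd t).hasDerivWithinAt)
    (by simp) (fun t => hB t) (fun t ht => by
      calc ‖inner ℝ (gradient F (x + t • h) - g - t • H) h‖
          ≤ ‖gradient F (x + t • h) - g - t • H‖ * ‖h‖ := norm_inner_le_norm _ _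
        _ ≤ L * ‖h‖ ^ 2 / 2 * t ^ 2 * ‖h‖ := by
          gcongr
          exact norm_gradient_add_smul_sub_le hF hL x h ht.1
        _ = L * ‖h‖ ^ 3 / 2 * t ^ 2 := by ring) (x := 1) ⟨zero_le_one, le_rfl⟩
  have := (le_abs_self _).trans key
  simp only [one_smul, one_pow, one_mul, mul_one] at this
  linarith

end Taylor

/-! ### Derivatives of averages. -/

section Average

variable {n : ℕ}

/-- The average of finitely many functions. -/
def average {E : Type*} (f : Fin n → E → ℝ) (x : E) : ℝ := (1 / (n : ℝ)) * ∑ i, f i x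

theorem contDiff_average {E : Type*} [NormedAddCommGroup E] [InnerProductSpace ℝ E]
    {f : Fin n → E → ℝ} (hf : ∀ i, ContDiff ℝ 2 (f i)) : ContDiff ℝ 2 (average f) :=
  contDiff_const.mul (ContDiff.sum fun i _ => hf i)

variable {E : Type*} [NormedAddCommGroup E] [InnerProductSpace ℝ E] [CompleteSpace E]
  {f : Fin n → E → ℝ}

theorem gradient_average (hf : ∀ i, ContDiff ℝ 2 (f i)) (x : E) :
    gradient (average f) x = (1 / (n : ℝ)) • ∑ i, gradient (f i) x := by
  refine HasGradientAt.gradient ?_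
  rw [hasGradientAt_iff_hasFDerivAt]
  have h := (HasFDerivAt.fun_sum (u := Finset.univ) fun i _ =>
    (hasGradientAt_of_contDiff (hf i) x).hasFDerivAt).const_mul (1 / (n : ℝ))
  refine h.congr_fderiv ?_
  simp [map_sum]

theorem hess_average (hf : ∀ i, ContDiff ℝ 2 (f i)) (x : E) :
    hess (average f) x = (1 / (n : ℝ)) • ∑ i, hess (f i) x := by
  have h : gradient (average f) = fun x => (1 / (n : ℝ)) • ∑ i, gradient (f i) x :=
    funext (gradient_average hf)
  unfold hess
  rw [h]
  exact ((HasFDerivAt.fun_sum (u := Finset.univ) fun i _ =>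
    hasFDerivAt_gradient (hf i) x).const_smul (1 / (n : ℝ))).fderiv

theorem norm_hess_average_sub_le [NeZero n] (hf : ∀ i, ContDiff ℝ 2 (f i)) {L : ℝ}
    (hL : ∀ i x y, ‖hess (f i) x - hess (f i) y‖ ≤ L * ‖x - y‖) (x y : E) :
    ‖hess (average f) x - hess (average f) y‖ ≤ L * ‖x - y‖ := by
  have hn : (0 : ℝ) < n := by exact_mod_cast Nat.pos_of_neZero n
  rw [hess_average hf, hess_average hf, ← smul_sub, ← Finset.sum_sub_distrib, norm_smul,
    Real.norm_of_nonneg (by positivity), one_div, inv_mul_le_iff₀ hn]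
  refine (norm_sum_le _ _).trans ((Finset.sum_le_sum fun i _ => hL i x y).trans ?_)
  simp

end Average

/-! ### Global minimizers of the cubic model. -/

section CubicModel

variable {E : Type*} [NormedAddCommGroup E] [InnerProductSpace ℝ E] {v h : E} {U : E →L[ℝ] E}
  {m : ℝ}

/-- The cubic model `⟨v, h⟩ + ½ ⟨U h, h⟩ + (m/6) ‖h‖³` on an inner product space. -/
def cubic (v : E) (U : E →L[ℝ] E) (m : ℝ) (h : E) : ℝ :=
  inner ℝ v h + (1 / 2) * inner ℝ (U h) h + (m / 6) * ‖h‖ ^ 3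

theorem hasFDerivAt_norm_pow_three (h : E) :
    HasFDerivAt (fun h : E => ‖h‖ ^ 3) ((3 * ‖h‖) • innerSL ℝ h) h := by
  have h1 := hasFDerivAt_norm_rpow h (p := 3) (by norm_num)
  norm_num at h1
  exact_mod_cast h1

theorem cubic_stationary (hU : (U : E →ₗ[ℝ] E).IsSymmetric)
    (hmin : ∀ h', cubic v U m h ≤ cubic v U m h') : v + U h + (m / 2 * ‖h‖) • h = 0 := by
  have h1 : HasFDerivAt (fun h : E => inner ℝ v h) (innerSL ℝ v) h := (innerSL ℝ v).hasFDerivAt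
  have h2 := (((U.hasFDerivAt (x := h)).inner ℝ (hasFDerivAt_id h)).const_mul (1 / 2 : ℝ))
  have h3 := (hasFDerivAt_norm_pow_three h).const_mul (m / 6)
  have h4 := IsLocalMin.hasFDerivAt_eq_zero (f := cubic v U m) (a := h)
    (Filter.Eventually.of_forall hmin) ((h1.add h2).add h3)
  refine ext_inner_right ℝ fun z => ?_
  have h5 := congrArg (fun T : E →L[ℝ] ℝ => T z) h4
  have h6 : inner ℝ (U z) h = inner ℝ (U h) z := by
    rw [real_inner_comm]; exact (hU h z).symm
  simp [h6] at h5
  simp only [inner_add_left, inner_smul_left, inner_zero_left]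
  simp only [conj_trivial]
  linarith

/-- The linear term is the only part of the model that is odd in `h`. -/
theorem inner_nonpos_of_cubic_le_neg (hneg : cubic v U m h ≤ cubic v U m (-h)) :
    inner ℝ v h ≤ 0 := by
  simp only [cubic, map_neg, inner_neg_left, norm_neg, inner_neg_right] at hneg
  linarith

/-- Pairing the stationarity equation with `h` eliminates `⟨U h, h⟩`; the value at the minimizer is
`½⟨v, h⟩ - (m/12) ‖h‖³`. -/
theorem cubic_le_of_forall_le (hU : (U : E →ₗ[ℝ] E).IsSymmetric)
    (hmin : ∀ h', cubic v U m h ≤ cubic v U m h') : cubic v U m h ≤ -(m / 12) * ‖h‖ ^ 3 := by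
  have h1 := inner_nonpos_of_cubic_le_neg (hmin (-h))
  have h2 := congrArg (fun z => inner ℝ z h) (cubic_stationary hU hmin)
  simp only [inner_add_left, inner_smul_left, inner_zero_left, real_inner_self_eq_norm_sq,
    conj_trivial] at h2
  unfold cubic
  nlinarith

/-- Adding the comparisons with `h + w` and `h - w` cancels the linear and mixed terms and isolates
`⟨U w, w⟩`. For `‖w‖ ≥ ‖h‖` both cubes are at most `8 ‖w‖³`, hence the constant `16/6 = 8/3`; `w` is
then a multiple of `z` of length close to `‖h‖`. -/
theorem curvature_of_forall_le (hm : 0 < m) (hmin : ∀ h', cubic v U m h ≤ cubic v U m h') (z : E) :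
    -(8 / 3 * m * ‖h‖) * ‖z‖ ^ 2 ≤ inner ℝ (U z) z := by
  have key : ∀ w : E, ‖h‖ ≤ ‖w‖ → -(8 / 3 * m) * ‖w‖ ^ 3 ≤ inner ℝ (U w) w := by
    intro w hw
    have h1 := hmin (h + w)
    have h2 := hmin (h - w)
    have h3 : ‖h + w‖ ^ 3 ≤ (2 * ‖w‖) ^ 3 :=
      pow_le_pow_left₀ (norm_nonneg _) (by linarith [norm_add_le h w]) 3
    have h4 : ‖h - w‖ ^ 3 ≤ (2 * ‖w‖) ^ 3 :=
      pow_le_pow_left₀ (norm_nonneg _) (by linarith [norm_sub_le h w]) 3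
    have h5 : 0 ≤ ‖h‖ ^ 3 := by positivity
    simp only [cubic, map_add, map_sub, inner_add_left, inner_sub_left, inner_add_right,
      inner_sub_right] at h1 h2
    nlinarith
  rcases eq_or_ne z 0 with rfl | hz
  · simp
  have hz' : 0 < ‖z‖ := norm_pos_iff.2 hz
  -- The slack keeps `w` nonzero when `h = 0`.
  refine le_of_forall_pos_le_add fun ε hε => ?_
  set η := ε / (8 / 3 * m * ‖z‖ ^ 2) with hη
  have hη' : 0 < η := by positivity
  have hb : 0 < ‖h‖ + η := by positivity
  have hw : ‖((‖h‖ + η) / ‖z‖) • z‖ = ‖h‖ + η := by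
    rw [norm_smul, Real.norm_of_nonneg (by positivity), div_mul_cancel₀ _ hz'.ne']
  have h1 := key (((‖h‖ + η) / ‖z‖) • z) (by rw [hw]; linarith)
  rw [hw, map_smul, inner_smul_left, inner_smul_right] at h1
  simp only [conj_trivial] at h1
  have h2 : -(8 / 3 * m) * (‖h‖ + η) * ‖z‖ ^ 2 ≤ inner ℝ (U z) z := by
    have h3 : (‖h‖ + η) / ‖z‖ * ((‖h‖ + η) / ‖z‖ * inner ℝ (U z) z)
        = (‖h‖ + η) ^ 2 / ‖z‖ ^ 2 * inner ℝ (U z) z := by field_simp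
    rw [h3, div_mul_eq_mul_div ((‖h‖ + η) ^ 2), le_div_iff₀ (by positivity)] at h1
    refine le_of_mul_le_mul_left ?_ (pow_pos hb 2)
    linarith
  have h3 : 8 / 3 * m * η * ‖z‖ ^ 2 = ε := by rw [hη]; field_simp
  linarith

end CubicModel

/-! ### Scalar inequalities. -/

section Scalar

theorem add_pow_three_le {x y : ℝ} (hx : 0 ≤ x) (hy : 0 ≤ y) :
    (x + y) ^ 3 ≤ 4 * (x ^ 3 + y ^ 3) := by
  have := add_pow_le hx hy 3
  norm_num at this
  exact this

theorem add_add_pow_three_le {x y z : ℝ} (hx : 0 ≤ x) (hy : 0 ≤ y) (hz : 0 ≤ z) :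
    (x + y + z) ^ 3 ≤ 16 * (x ^ 3 + y ^ 3 + z ^ 3) := by
  have h1 := add_pow_three_le (add_nonneg hx hy) hz
  have h2 := add_pow_three_le hx hy
  have h3 : 0 ≤ z ^ 3 := by positivity
  linarith

/-- Used with `w = √m`, `u² = ‖v - ∇F‖` and `a = ‖h‖` to absorb the gradient error. The threshold 5
works because `5² ≥ 24`. -/
theorem sq_mul_le_cubes {u w a : ℝ} (hu : 0 ≤ u) (hw : 0 < w) (ha : 0 ≤ a) :
    u ^ 2 * a ≤ w ^ 2 / 24 * a ^ 3 + 72 / w * u ^ 3 := by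
  rcases le_total (w * a) (5 * u) with h | h
  · have h1 : u ^ 2 * a ≤ 72 / w * u ^ 3 := by
      rw [div_mul_eq_mul_div, le_div_iff₀ hw]
      nlinarith [mul_le_mul_of_nonneg_left h (sq_nonneg u), pow_nonneg hu 3]
    have : 0 ≤ w ^ 2 / 24 * a ^ 3 := by positivity
    linarith
  · have h1 : u ^ 2 * a ≤ w ^ 2 / 24 * a ^ 3 := by
      have h2 : (5 * u) ^ 2 ≤ (w * a) ^ 2 := pow_le_pow_left₀ (by positivity) h 2
      nlinarith [mul_le_mul_of_nonneg_right h2 ha, mul_nonneg (sq_nonneg u) ha]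
    have : 0 ≤ 72 / w * u ^ 3 := by positivity
    linarith

/-- The counterpart for the Hessian error `D`. The threshold 12 makes the second case exact, and the
first case then yields `½ · 12² = 72`. -/
theorem mul_sq_le_cubes {D w a : ℝ} (hD : 0 ≤ D) (hw : 0 < w) (ha : 0 ≤ a) :
    1 / 2 * D * a ^ 2 ≤ w ^ 2 / 24 * a ^ 3 + 72 / w * (D ^ 3 / w ^ 3) := by
  rcases le_total (w ^ 2 * a) (12 * D) with h | h
  · have h1 : 1 / 2 * D * a ^ 2 ≤ 72 / w * (D ^ 3 / w ^ 3) := by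
      have h2 : (w ^ 2 * a) ^ 2 ≤ (12 * D) ^ 2 := pow_le_pow_left₀ (by positivity) h 2
      rw [div_mul_div_comm, le_div_iff₀ (by positivity)]
      nlinarith [mul_le_mul_of_nonneg_left h2 hD]
    have : 0 ≤ w ^ 2 / 24 * a ^ 3 := by positivity
    linarith
  · have h1 : 1 / 2 * D * a ^ 2 ≤ w ^ 2 / 24 * a ^ 3 := by
      nlinarith [mul_le_mul_of_nonneg_right h (sq_nonneg a)]
    have : 0 ≤ 72 / w * (D ^ 3 / w ^ 3) := by positivity
    linarith

/-- In terms of square roots the estimates become polynomial or rational. -/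
theorem rpow_three_halves {x : ℝ} (hx : 0 ≤ x) : x ^ (3 / 2 : ℝ) = √x ^ 3 := by
  rw [Real.rpow_div_two_eq_sqrt _ hx]
  exact_mod_cast Real.rpow_natCast (√x) 3

/-- Weighted Young inequality for the cube of a sum. -/
theorem add_pow_three_le_weighted {a b α β : ℝ} (ha : 0 ≤ a) (hb : 0 ≤ b) (hα : 0 < α)
    (hβ : 0 < β) : (a + b) ^ 3 ≤ (1 + 2 * α + β) * a ^ 3
      + (1 + 1 / α ^ 2 + 2 / β ^ (1 / 2 : ℝ)) * b ^ 3 := by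
  rw [← Real.sqrt_eq_rpow]
  obtain ⟨σ, hσ, rfl⟩ : ∃ σ, 0 < σ ∧ β = σ ^ 2 :=
    ⟨√β, Real.sqrt_pos.2 hβ, (Real.sq_sqrt hβ.le).symm⟩
  rw [Real.sqrt_sq hσ.le]
  have h1 : 3 * a ^ 2 * b ≤ 2 * α * a ^ 3 + 1 / α ^ 2 * b ^ 3 := by
    rw [div_mul_eq_mul_div, ← sub_nonneg]
    have : 2 * α * a ^ 3 + 1 * b ^ 3 / α ^ 2 - 3 * a ^ 2 * b
        = (α * a - b) ^ 2 * (2 * α * a + b) / α ^ 2 := by field_simp; ring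
    rw [this]
    positivity
  have h2 : 3 * a * b ^ 2 ≤ σ ^ 2 * a ^ 3 + 2 / σ * b ^ 3 := by
    rw [div_mul_eq_mul_div, ← sub_nonneg]
    have : σ ^ 2 * a ^ 3 + 2 * b ^ 3 / σ - 3 * a * b ^ 2
        = (σ * a - b) ^ 2 * (σ * a + 2 * b) / σ := by field_simp; ring
    rw [this]
    positivity
  linarith [show (a + b) ^ 3 = a ^ 3 + 3 * a ^ 2 * b + 3 * a * b ^ 2 + b ^ 3 by ring]

end Scalar

/-! ### One cubic step with inexact derivatives. -/

section Step

variable {E : Type*} [NormedAddCommGroup E] [InnerProductSpace ℝ E] [CompleteSpace E] {F : E → ℝ}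
  {L m : ℝ} {x v h : E} {U : E →L[ℝ] E}

/-- The decrease of the objective along an inexact cubic step. -/
theorem apply_add_le_of_cubic_step (hF : ContDiff ℝ 2 F)
    (hL : ∀ x y, ‖hess F x - hess F y‖ ≤ L * ‖x - y‖) (hL0 : 0 < L) (hm : 2 * L < m)
    (hU : (U : E →ₗ[ℝ] E).IsSymmetric) (hmin : ∀ h', cubic v U m h ≤ cubic v U m h') :
    F (x + h) ≤ F x - m / 12 * ‖h‖ ^ 3 + 72 / m ^ (1 / 2 : ℝ) *
      (‖v - gradient F x‖ ^ (3 / 2 : ℝ) + ‖U - hess F x‖ ^ 3 / m ^ (3 / 2 : ℝ)) := by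
  have hm0 : 0 < m := by linarith
  rw [rpow_three_halves (norm_nonneg _), rpow_three_halves hm0.le, ← Real.sqrt_eq_rpow]
  set w := √m
  have hw : 0 < w := Real.sqrt_pos.2 hm0
  have hmw : w ^ 2 = m := Real.sq_sqrt hm0.le
  set u := √‖v - gradient F x‖
  have hu : 0 ≤ u := Real.sqrt_nonneg _
  have hue : u ^ 2 = ‖v - gradient F x‖ := Real.sq_sqrt (norm_nonneg _)
  have h1 := apply_add_le_cubic hF hL x h
  have h2 := cubic_le_of_forall_le hU hmin
  unfold cubic at h2
  have h3 : inner ℝ (gradient F x) h - inner ℝ v h ≤ u ^ 2 * ‖h‖ := by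
    rw [← inner_sub_left, hue, ← norm_neg (v - _), neg_sub]
    exact real_inner_le_norm _ _
  have h4 : inner ℝ (hess F x h) h - inner ℝ (U h) h ≤ ‖U - hess F x‖ * ‖h‖ ^ 2 := by
    rw [← inner_sub_left, ← norm_neg (U - _), neg_sub, sq, ← mul_assoc]
    refine (real_inner_le_norm _ _).trans ?_
    gcongr
    exact (hess F x - U).le_opNorm h
  -- Balance of `‖h‖³` in units of `m/12`: the minimal model value gives -1, removing the cubic term
  -- of the model -2, the Taylor remainder at most +1 since `L ≤ m/2`, and each of the two errors
  -- +1/2. The total is -1.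
  have h5 := sq_mul_le_cubes hu hw (norm_nonneg h)
  have h6 := mul_sq_le_cubes (norm_nonneg (U - hess F x)) hw (norm_nonneg h)
  rw [hmw] at h5 h6
  have h7 : L * ‖h‖ ^ 3 ≤ m / 2 * ‖h‖ ^ 3 := by gcongr; linarith
  linarith

/-- Stationarity of the model writes `∇F(x + h)` as Taylor remainder, estimation errors and `-(m/2)
‖h‖ h`. The resulting bound is dominated by the square of `√m ‖h‖ + √‖v - ∇F‖ + ‖U - ∇²F‖ / √m`. -/
theorem norm_gradient_rpow_le_of_cubic_step (hF : ContDiff ℝ 2 F)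
    (hL : ∀ x y, ‖hess F x - hess F y‖ ≤ L * ‖x - y‖) (hL0 : 0 < L) (hm : 2 * L < m)
    (hU : (U : E →ₗ[ℝ] E).IsSymmetric) (hmin : ∀ h', cubic v U m h ≤ cubic v U m h') :
    ‖gradient F (x + h)‖ ^ (3 / 2 : ℝ) ≤ 300 * (m ^ (3 / 2 : ℝ) * ‖h‖ ^ 3 +
      (‖v - gradient F x‖ ^ (3 / 2 : ℝ) + ‖U - hess F x‖ ^ 3 / m ^ (3 / 2 : ℝ))) := by
  have hm0 : 0 < m := by linarith
  rw [rpow_three_halves (norm_nonneg _), rpow_three_halves (norm_nonneg _),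
    rpow_three_halves hm0.le]
  set w := √m
  have hw : 0 < w := Real.sqrt_pos.2 hm0
  have hmw : w ^ 2 = m := Real.sq_sqrt hm0.le
  set u := √‖v - gradient F x‖
  have hu : 0 ≤ u := Real.sqrt_nonneg _
  have hue : u ^ 2 = ‖v - gradient F x‖ := Real.sq_sqrt (norm_nonneg _)
  set a := ‖h‖ with ha
  have ha0 : 0 ≤ a := norm_nonneg _
  set D := ‖U - hess F x‖ with hD
  have hD0 : 0 ≤ D := norm_nonneg _
  have h0 : gradient F (x + h) = (gradient F (x + h) - gradient F x - hess F x h)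
      - (v - gradient F x) - (U - hess F x) h - (m / 2 * a) • h := by
    have h1 := cubic_stationary hU hmin
    have h2 : (m / 2 * a) • h = -(v + U h) := by rw [eq_neg_iff_add_eq_zero, add_comm]; exact h1
    rw [h2, sub_apply]
    abel
  have hN : ‖gradient F (x + h)‖ ≤ L * a ^ 2 / 2 + u ^ 2 + D * a + m / 2 * a ^ 2 := by
    rw [h0, hue]
    refine (norm_sub_le _ _).trans (add_le_add ((norm_sub_le _ _).trans (add_le_add
      ((norm_sub_le _ _).trans (add_le_add (norm_gradient_add_sub_le hF hL x h) le_rfl))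
      ((U - hess F x).le_opNorm h))) ?_)
    rw [norm_smul, Real.norm_of_nonneg (by positivity), ← ha]
    exact le_of_eq (by ring)
  have hN2 : √‖gradient F (x + h)‖ ≤ w * a + u + D / w := by
    refine Real.sqrt_le_iff.2 ⟨by positivity, hN.trans ?_⟩
    have h1 : (w * a + u + D / w) ^ 2 = w ^ 2 * a ^ 2 + u ^ 2 + (D / w) ^ 2 + 2 * (w * a) * u
        + 2 * (D * a) + 2 * u * (D / w) := by field_simp; ring
    rw [h1, hmw]
    have : L * a ^ 2 ≤ m * a ^ 2 := by gcongr; linarith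
    have : 0 ≤ (D / w) ^ 2 + 2 * (w * a) * u + D * a + 2 * u * (D / w) := by positivity
    linarith
  refine (pow_le_pow_left₀ (Real.sqrt_nonneg _) hN2 3).trans ?_
  refine (add_add_pow_three_le (by positivity) hu (by positivity)).trans ?_
  rw [mul_pow, div_pow]
  have : 0 ≤ w ^ 3 * a ^ 3 + u ^ 3 + D ^ 3 / w ^ 3 := by positivity
  linarith

/-- The curvature of `U` is transferred to `hess F x` and on to `hess F (x + h)`. The coefficient 4
covers `8/3` from the model and at most 1 from the Lipschitz bound. -/
theorem curvature_of_cubic_step (hL : ∀ x y, ‖hess F x - hess F y‖ ≤ L * ‖x - y‖) (hL0 : 0 < L)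
    (hm : 2 * L < m) (hmin : ∀ h', cubic v U m h ≤ cubic v U m h') (z : E) :
    -(4 * m * ‖h‖ + ‖U - hess F x‖) * ‖z‖ ^ 2 ≤ inner ℝ (hess F (x + h) z) z := by
  have hop : ∀ A B : E →L[ℝ] E, inner ℝ (A z) z - inner ℝ (B z) z ≤ ‖A - B‖ * ‖z‖ ^ 2 := by
    intro A B
    rw [← inner_sub_left, sq, ← mul_assoc]
    refine (real_inner_le_norm _ _).trans ?_
    gcongr
    exact (A - B).le_opNorm z
  have h1 := curvature_of_forall_le (by linarith) hmin z
  have h2 := hop U (hess F x)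
  have h3 := hop (hess F x) (hess F (x + h))
  have h4 : ‖hess F x - hess F (x + h)‖ * ‖z‖ ^ 2 ≤ L * ‖h‖ * ‖z‖ ^ 2 := by
    gcongr
    simpa using hL x (x + h)
  have h5 : L * ‖h‖ * ‖z‖ ^ 2 ≤ m * ‖h‖ * ‖z‖ ^ 2 := by gcongr; linarith
  have h6 : 0 ≤ m * ‖h‖ * ‖z‖ ^ 2 := by
    have : 0 < m := by linarith
    positivity
  linarith

/-- Odd powers are monotone on the whole line, so the sign of `lam` is irrelevant. The constant 300
covers `4 · 4³ = 256`. -/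
theorem neg_pow_three_mul_rpow_le {lam a D m : ℝ} (hm : 0 < m) (ha : 0 ≤ a) (hD : 0 ≤ D)
    (h : -(4 * m * a + D) ≤ lam) :
    -lam ^ 3 * m ^ (-(3 / 2) : ℝ) ≤ 300 * (m ^ (3 / 2 : ℝ) * a ^ 3 + D ^ 3 / m ^ (3 / 2 : ℝ)) := by
  rw [Real.rpow_neg hm.le, rpow_three_halves hm.le]
  set w := √m
  have hw : 0 < w := Real.sqrt_pos.2 hm
  have hmw : w ^ 2 = m := Real.sq_sqrt hm.le
  have h1 : -lam ^ 3 ≤ (4 * m * a + D) ^ 3 := by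
    rw [← Odd.neg_pow (by decide : Odd 3)]
    exact (Odd.pow_le_pow (by decide : Odd 3)).2 (by linarith)
  have h2 := h1.trans (add_pow_three_le (by positivity) hD)
  rw [← div_eq_mul_inv, div_le_iff₀ (by positivity)]
  refine h2.trans ?_
  have h3 : 300 * (w ^ 3 * a ^ 3 + D ^ 3 / w ^ 3) * w ^ 3 = 300 * (m ^ 3 * a ^ 3 + D ^ 3) := by
    rw [← hmw]; field_simp
  rw [h3, mul_pow, mul_pow]
  have : 0 ≤ m ^ 3 * a ^ 3 := by positivity
  have : 0 ≤ D ^ 3 := by positivity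
  linarith

end Step

/-! ### Errors of the variance-reduced estimators. -/

section BatchMean

variable {n b : ℕ}

theorem batchMean_sub_eq {E : Type*} [AddCommGroup E] [Module ℝ E] (hb : 0 < b) (g : Fin n → E)
    (I : Fin b → Fin n) : (1 / (b : ℝ)) • ∑ k, g (I k) - (1 / (n : ℝ)) • ∑ i, g i
      = (1 / (b : ℝ)) • batchSum (fun i => g i - (1 / (n : ℝ)) • ∑ j, g j) I := by
  have hb' : (b : ℝ) ≠ 0 := by positivity
  rw [batchSum, Finset.sum_sub_distrib, smul_sub]
  congr 1
  rw [Finset.sum_const, Finset.card_univ, Fintype.card_fin, ← Nat.cast_smul_eq_nsmul ℝ b,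
    smul_smul, one_div_mul_cancel hb', one_smul]

theorem sum_sub_mean_eq_zero {E : Type*} [AddCommGroup E] [Module ℝ E] (hn : 0 < n)
    (g : Fin n → E) : ∑ i, (g i - (1 / (n : ℝ)) • ∑ j, g j) = 0 := by
  have hn' : (n : ℝ) ≠ 0 := by positivity
  rw [Finset.sum_sub_distrib, Finset.sum_const, Finset.card_univ, Fintype.card_fin,
    ← Nat.cast_smul_eq_nsmul ℝ n, smul_smul, mul_one_div_cancel hn', one_smul, sub_self]

variable {E : Type*} [NormedAddCommGroup E] [InnerProductSpace ℝ E]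

theorem mean_norm_rpow_sub_mean_le (hn : 0 < n) (hb : 0 < b) (g : Fin n → E) {δ : ℝ}
    (hδ : ∀ i j, ‖g i - g j‖ ≤ δ) :
    ((n : ℝ) ^ b)⁻¹ * ∑ I : Fin b → Fin n,
      ‖(1 / (b : ℝ)) • ∑ k, g (I k) - (1 / (n : ℝ)) • ∑ i, g i‖ ^ (3 / 2 : ℝ)
        ≤ (δ ^ 2 / b) ^ (3 / 4 : ℝ) := by
  simp only [batchMean_sub_eq hb]
  exact mean_norm_rpow_batchMean_le hn hb _ (sum_sub_mean_eq_zero hn g)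
    (fun i j => by simpa using hδ i j)

theorem isSymmetric_sum {ι : Type*} (s : Finset ι) {T : ι → E →L[ℝ] E}
    (hT : ∀ i, (T i : E →ₗ[ℝ] E).IsSymmetric) :
    ((∑ i ∈ s, T i : E →L[ℝ] E) : E →ₗ[ℝ] E).IsSymmetric := by
  intro x z
  simp only [ContinuousLinearMap.coe_coe, sum_apply, sum_inner, inner_sum]
  exact Finset.sum_congr rfl fun i _ => hT i x z

theorem isSymmetric_smul (a : ℝ) {T : E →L[ℝ] E} (hT : (T : E →ₗ[ℝ] E).IsSymmetric) :
    ((a • T : E →L[ℝ] E) : E →ₗ[ℝ] E).IsSymmetric := by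
  intro x z
  have : inner ℝ (T x) z = inner ℝ x (T z) := hT x z
  simp [inner_smul_left, inner_smul_right, this]

theorem mean_norm_pow_three_sub_mean_le [FiniteDimensional ℝ E] (hn : 0 < n) (hb : 0 < b)
    (hd : 2 ≤ Module.finrank ℝ E) (g : Fin n → E →L[ℝ] E)
    (hs : ∀ i, (g i : E →ₗ[ℝ] E).IsSymmetric) {δ : ℝ} (hδ : ∀ i j, ‖g i - g j‖ ≤ δ) :
    ((n : ℝ) ^ b)⁻¹ * ∑ J : Fin b → Fin n,
      ‖(1 / (b : ℝ)) • ∑ k, g (J k) - (1 / (n : ℝ)) • ∑ i, g i‖ ^ 3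
        ≤ (25 * Real.log (Module.finrank ℝ E) * δ ^ 2 / b) ^ (3 / 2 : ℝ) := by
  simp only [batchMean_sub_eq hb]
  exact mean_norm_pow_three_batchMean_le hn hb hd _
    (fun i => isSymmetric_sub (hs i) (isSymmetric_smul _ (isSymmetric_sum _ hs)))
    (sum_sub_mean_eq_zero hn g) (fun i j => by simpa using hδ i j)

end BatchMean

section Estimators

variable {E : Type*} [NormedAddCommGroup E] [InnerProductSpace ℝ E] [CompleteSpace E] {n b : ℕ}
  {f : Fin n → E → ℝ} {L : ℝ}

/-- The variance-reduced gradient estimate on a Hilbert space. -/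
def gradEstimate (f : Fin n → E → ℝ) (r x : E) (I : Fin b → Fin n) : E :=
  (1 / (b : ℝ)) • ∑ k, (gradient (f (I k)) x - gradient (f (I k)) r) + gradient (average f) r

/-- The variance-reduced Hessian estimate on a Hilbert space. -/
def hessEstimate (f : Fin n → E → ℝ) (r x : E) (J : Fin b → Fin n) : E →L[ℝ] E :=
  (1 / (b : ℝ)) • ∑ k, (hess (f (J k)) x - hess (f (J k)) r) + hess (average f) r

theorem gradEstimate_self (r : E) (I : Fin b → Fin n) :
    gradEstimate f r r I = gradient (average f) r := by
  simp [gradEstimate]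

theorem isSymmetric_hessEstimate (hf : ∀ i, ContDiff ℝ 2 (f i)) (r x : E) (J : Fin b → Fin n) :
    (hessEstimate f r x J : E →ₗ[ℝ] E).IsSymmetric := by
  have h1 := isSymmetric_smul (1 / (b : ℝ)) (isSymmetric_sum Finset.univ fun k =>
    isSymmetric_sub (isSymmetric_hess (hf (J k)) x) (isSymmetric_hess (hf (J k)) r))
  exact h1.add (isSymmetric_hess (contDiff_average hf) r)

theorem gradEstimate_sub (hf : ∀ i, ContDiff ℝ 2 (f i)) (r x : E) (I : Fin b → Fin n) :
    gradEstimate f r x I - gradient (average f) x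
      = (1 / (b : ℝ)) • ∑ k, (gradient (f (I k)) x - gradient (f (I k)) r)
        - (1 / (n : ℝ)) • ∑ i, (gradient (f i) x - gradient (f i) r) := by
  rw [gradEstimate, gradient_average hf, gradient_average hf, Finset.sum_sub_distrib (s := Finset.univ (α := Fin n)),
    smul_sub (1 / (n : ℝ))]
  abel

theorem hessEstimate_sub (hf : ∀ i, ContDiff ℝ 2 (f i)) (r x : E) (J : Fin b → Fin n) :
    hessEstimate f r x J - hess (average f) x
      = (1 / (b : ℝ)) • ∑ k, (hess (f (J k)) x - hess (f (J k)) r)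
        - (1 / (n : ℝ)) • ∑ i, (hess (f i) x - hess (f i) r) := by
  rw [hessEstimate, hess_average hf, hess_average hf,
    Finset.sum_sub_distrib (s := Finset.univ (α := Fin n)), smul_sub (1 / (n : ℝ))]
  abel

theorem norm_sub_le_two_mul {G : Type*} [NormedAddCommGroup G] {g : Fin n → G} {K : ℝ}
    (hg : ∀ i, ‖g i‖ ≤ K) (i j : Fin n) : ‖g i - g j‖ ≤ 2 * K :=
  (norm_sub_le _ _).trans (by linarith [hg i, hg j])

theorem rpow_mul_pow_four_three_fourths {z a : ℝ} (hz : 0 ≤ z) (ha : 0 ≤ a) :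
    (z * a ^ 4) ^ (3 / 4 : ℝ) = z ^ (3 / 4 : ℝ) * a ^ 3 := by
  rw [Real.mul_rpow hz (by positivity), ← Real.rpow_natCast a 4, ← Real.rpow_mul ha,
    ← Real.rpow_natCast a 3]
  norm_num

theorem rpow_mul_sq_three_halves {z a : ℝ} (hz : 0 ≤ z) (ha : 0 ≤ a) :
    (z * a ^ 2) ^ (3 / 2 : ℝ) = z ^ (3 / 2 : ℝ) * a ^ 3 := by
  rw [Real.mul_rpow hz (by positivity), ← Real.rpow_natCast a 2, ← Real.rpow_mul ha,
    ← Real.rpow_natCast a 3]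
  norm_num

/-- The `3/2`-th moment of the error of the gradient estimate. -/
theorem mean_gradEstimate_error_le (hn : 0 < n) (hf : ∀ i, ContDiff ℝ 2 (f i)) {L₁ L₂ D : ℝ}
    (hL₂ : 0 < L₂) (hD : 0 < D)
    (hL : ∀ i x y, ‖gradient (f i) x - gradient (f i) y‖ ≤ L₁ * ‖x - y‖) (r x : E)
    (hb : b = ⌈D / ‖x - r‖ ^ 2⌉₊) :
    ((n : ℝ) ^ b)⁻¹ * ∑ I : Fin b → Fin n,
      ‖gradEstimate f r x I - gradient (average f) x‖ ^ (3 / 2 : ℝ)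
        ≤ L₂ ^ (3 / 2 : ℝ) * (4 * L₁ ^ 2 / (D * L₂ ^ 2)) ^ (3 / 4 : ℝ) * ‖x - r‖ ^ 3 := by
  -- For `x = r` the batch is empty, as division by zero gives 0, but the estimate is exact.
  rcases eq_or_ne x r with rfl | hxr
  · simp [gradEstimate_self]
  have hρ : 0 < ‖x - r‖ := norm_pos_iff.2 (sub_ne_zero.2 hxr)
  have hb0 : 0 < b := hb ▸ Nat.ceil_pos.2 (by positivity)
  have hbD : D / ‖x - r‖ ^ 2 ≤ b := hb ▸ Nat.le_ceil _
  simp only [gradEstimate_sub hf]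
  refine (mean_norm_rpow_sub_mean_le hn hb0 (fun i => gradient (f i) x - gradient (f i) r)
    (norm_sub_le_two_mul fun i => hL i x r)).trans ?_
  -- The batch size contributes another `‖x - r‖²`; the power 3/4 of `‖x - r‖⁴` is the cube that the
  -- Lyapunov function needs.
  have h1 : (2 * (L₁ * ‖x - r‖)) ^ 2 / b ≤ 4 * L₁ ^ 2 / (D * L₂ ^ 2) * L₂ ^ 2 * ‖x - r‖ ^ 4 := by
    calc (2 * (L₁ * ‖x - r‖)) ^ 2 / b ≤ (2 * (L₁ * ‖x - r‖)) ^ 2 / (D / ‖x - r‖ ^ 2) := by gcongr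
      _ = _ := by field_simp; ring
  refine (Real.rpow_le_rpow (by positivity) h1 (by norm_num)).trans (le_of_eq ?_)
  rw [rpow_mul_pow_four_three_fourths (by positivity) hρ.le, Real.mul_rpow (by positivity) (by positivity),
    ← Real.rpow_natCast L₂ 2, ← Real.rpow_mul hL₂.le,
    show ((2 : ℕ) : ℝ) * (3 / 4) = 3 / 2 by norm_num]
  ring

/-- The third moment of the error of the Hessian estimate. -/
theorem mean_hessEstimate_error_le [FiniteDimensional ℝ E] (hn : 0 < n)
    (hd : 2 ≤ Module.finrank ℝ E) (hf : ∀ i, ContDiff ℝ 2 (f i)) {D : ℝ} (hL0 : 0 < L)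
    (hD : 0 < D) (hL : ∀ i x y, ‖hess (f i) x - hess (f i) y‖ ≤ L * ‖x - y‖) (r x : E)
    (hb : b = ⌈D⌉₊) :
    ((n : ℝ) ^ b)⁻¹ * ∑ J : Fin b → Fin n, ‖hessEstimate f r x J - hess (average f) x‖ ^ 3
      ≤ L ^ (3 / 2 : ℝ) * (1000 * L ^ (3 / 2 : ℝ) * Real.log (Module.finrank ℝ E) ^ (3 / 2 : ℝ)
        / D ^ (3 / 2 : ℝ)) * ‖x - r‖ ^ 3 := by
  have hb0 : 0 < b := hb ▸ Nat.ceil_pos.2 hD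
  have hbD : D ≤ b := hb ▸ Nat.le_ceil _
  simp only [hessEstimate_sub hf]
  have hl : 0 ≤ Real.log (Module.finrank ℝ E) := Real.log_natCast_nonneg _
  refine (mean_norm_pow_three_sub_mean_le hn hb0 hd (fun i => hess (f i) x - hess (f i) r)
    (fun i => isSymmetric_sub (isSymmetric_hess (hf i) x) (isSymmetric_hess (hf i) r))
    (norm_sub_le_two_mul fun i => hL i x r)).trans ?_
  set l := Real.log (Module.finrank ℝ E)
  -- Here `25 · 2² = 100`, whose power 3/2 is the constant 1000.
  have h1 : 25 * l * (2 * (L * ‖x - r‖)) ^ 2 / b ≤ 100 * l / D * (L * ‖x - r‖) ^ 2 := by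
    calc 25 * l * (2 * (L * ‖x - r‖)) ^ 2 / b ≤ 25 * l * (2 * (L * ‖x - r‖)) ^ 2 / D := by gcongr
      _ = _ := by ring
  refine (Real.rpow_le_rpow (by positivity) h1 (by norm_num)).trans (le_of_eq ?_)
  rw [rpow_mul_sq_three_halves (by positivity) (by positivity), Real.div_rpow (by positivity) hD.le,
    Real.mul_rpow (by norm_num) hl, mul_pow]
  have h2 : (100 : ℝ) ^ (3 / 2 : ℝ) = 1000 := by
    rw [rpow_three_halves (by norm_num), show (100 : ℝ) = 10 ^ 2 by norm_num,
      Real.sqrt_sq (by norm_num)]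
    norm_num
  have h3 : L ^ 3 = L ^ (3 / 2 : ℝ) * L ^ (3 / 2 : ℝ) := by
    rw [← Real.rpow_add hL0, ← Real.rpow_natCast]
    norm_num
  rw [h2, h3]
  ring

end Estimators

/-! ### The stationarity measure and the Lyapunov function. -/

section Criterion

variable {E : Type*} [NormedAddCommGroup E] [InnerProductSpace ℝ E]

/-- The smallest eigenvalue of an operator. -/
def minEigenvalue (T : E →L[ℝ] E) : ℝ :=
  sInf {r : ℝ | Module.End.HasEigenvalue (T : E →ₗ[ℝ] E) r}

theorem neg_le_minEigenvalue {T : E →L[ℝ] E} {κ : ℝ} (hκ : 0 ≤ κ)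
    (hT : ∀ z, -κ * ‖z‖ ^ 2 ≤ inner ℝ (T z) z) : -κ ≤ minEigenvalue T := by
  unfold minEigenvalue
  rcases Set.eq_empty_or_nonempty {r : ℝ | Module.End.HasEigenvalue (T : E →ₗ[ℝ] E) r} with h | h
  -- Without eigenvalues the infimum takes the default value 0, which still exceeds `-κ`.
  · rw [h, Real.sInf_empty]; linarith
  · refine le_csInf h fun r hr => ?_
    obtain ⟨z, hz⟩ := Module.End.HasEigenvalue.exists_hasEigenvector hr
    have hz0 : 0 < ‖z‖ := norm_pos_iff.2 hz.2
    have h1 : T z = r • z := hz.apply_eq_smul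
    have h2 := hT z
    rw [h1, inner_smul_left, real_inner_self_eq_norm_sq] at h2
    exact le_of_mul_le_mul_right h2 (by positivity)

variable [CompleteSpace E]

/-- The measure of second-order stationarity. -/
def criterion (F : E → ℝ) (m : ℝ) (x : E) : ℝ :=
  max (‖gradient F x‖ ^ (3 / 2 : ℝ)) (-(minEigenvalue (hess F x)) ^ 3 * m ^ (-(3 / 2) : ℝ))

theorem criterion_nonneg (F : E → ℝ) (m : ℝ) (x : E) : 0 ≤ criterion F m x :=
  le_max_of_le_left (by positivity)

/-- The error of a gradient estimate `v` and a Hessian estimate `U` at `x`. -/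
def noise (F : E → ℝ) (m : ℝ) (x v : E) (U : E →L[ℝ] E) : ℝ :=
  ‖v - gradient F x‖ ^ (3 / 2 : ℝ) + ‖U - hess F x‖ ^ 3 / m ^ (3 / 2 : ℝ)

variable {F : E → ℝ} {L m : ℝ} {x v h : E} {U : E →L[ℝ] E}

theorem criterion_le_of_cubic_step (hF : ContDiff ℝ 2 F)
    (hL : ∀ x y, ‖hess F x - hess F y‖ ≤ L * ‖x - y‖) (hL0 : 0 < L) (hm : 2 * L < m)
    (hU : (U : E →ₗ[ℝ] E).IsSymmetric) (hmin : ∀ h', cubic v U m h ≤ cubic v U m h') :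
    criterion F m (x + h) ≤ 300 * (m ^ (3 / 2 : ℝ) * ‖h‖ ^ 3 + noise F m x v U) := by
  have hm0 : 0 < m := by linarith
  refine max_le (norm_gradient_rpow_le_of_cubic_step hF hL hL0 hm hU hmin) ?_
  refine (neg_pow_three_mul_rpow_le hm0 (norm_nonneg h) (norm_nonneg (U - hess F x))
    (neg_le_minEigenvalue (by positivity) (curvature_of_cubic_step hL hL0 hm hmin))).trans ?_
  unfold noise
  have : 0 ≤ ‖v - gradient F x‖ ^ (3 / 2 : ℝ) := by positivity
  linarith

/-- One step of the algorithm decreases the Lyapunov function `F + c ‖· - r‖³`, up to noise. -/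
theorem lyapunov_le_of_cubic_step (hF : ContDiff ℝ 2 F)
    (hL : ∀ x y, ‖hess F x - hess F y‖ ≤ L * ‖x - y‖) (hL0 : 0 < L) (hm : 2 * L < m)
    (hU : (U : E →ₗ[ℝ] E).IsSymmetric) (hmin : ∀ h', cubic v U m h ≤ cubic v U m h')
    {α β γ c : ℝ} (hα : 0 < α) (hβ : 0 < β) (hγ : 0 < γ) (hc : 0 ≤ c)
    (hγc : γ = (m - 12 * c * (1 + 2 * α + β)) / (12 * m ^ (3 / 2 : ℝ))) (r : E) :
    F (x + h) + c * ‖x + h - r‖ ^ 3 + γ / 300 * criterion F m (x + h) ≤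
      F x + (72 + γ * m ^ (1 / 2 : ℝ)) / m ^ (1 / 2 : ℝ) * noise F m x v U
        + c * (1 + 1 / α ^ 2 + 2 / β ^ (1 / 2 : ℝ)) * ‖x - r‖ ^ 3 := by
  have hm0 : 0 < m := by linarith
  have h1 := apply_add_le_of_cubic_step (x := x) hF hL hL0 hm hU hmin
  change F (x + h) ≤ F x - m / 12 * ‖h‖ ^ 3 + 72 / m ^ (1 / 2 : ℝ) * noise F m x v U at h1
  have h2 := mul_le_mul_of_nonneg_left (criterion_le_of_cubic_step (x := x) hF hL hL0 hm hU hmin)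
    (show 0 ≤ γ / 300 by positivity)
  have h3 : ‖x + h - r‖ ^ 3 ≤ (1 + 2 * α + β) * ‖h‖ ^ 3
      + (1 + 1 / α ^ 2 + 2 / β ^ (1 / 2 : ℝ)) * ‖x - r‖ ^ 3 := by
    refine le_trans ?_ (add_pow_three_le_weighted (norm_nonneg h) (norm_nonneg (x - r)) hα hβ)
    refine pow_le_pow_left₀ (norm_nonneg _) ?_ 3
    rw [show x + h - r = h + (x - r) by abel]
    exact norm_add_le _ _
  have h4 := mul_le_mul_of_nonneg_left h3 hc
  have hm1 : 0 < m ^ (1 / 2 : ℝ) := by positivity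
  have hm2 : 0 < m ^ (3 / 2 : ℝ) := by positivity
  -- This is the purpose of the formula for `Γ`: the coefficients of `‖h‖³` cancel exactly.
  have h5 : γ * m ^ (3 / 2 : ℝ) = m / 12 - c * (1 + 2 * α + β) := by
    rw [hγc]; field_simp
  have h6 : (72 + γ * m ^ (1 / 2 : ℝ)) / m ^ (1 / 2 : ℝ) = 72 / m ^ (1 / 2 : ℝ) + γ := by
    field_simp
  have h7 : γ / 300 * (300 * (m ^ (3 / 2 : ℝ) * ‖h‖ ^ 3 + noise F m x v U))
      = (m / 12 - c * (1 + 2 * α + β)) * ‖h‖ ^ 3 + γ * noise F m x v U := by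
    rw [← h5]; ring
  rw [h6]
  rw [h7] at h2
  linarith

end Criterion

section MeanStep

variable {E : Type*} [NormedAddCommGroup E] [InnerProductSpace ℝ E] [FiniteDimensional ℝ E]
  {n b B : ℕ} {f : Fin n → E → ℝ}

/-- The noise is a function of `I` plus a function of `J`, so the double average separates into the
two moment bounds. -/
theorem mean_mean_noise_le (hn : 0 < n) (hd : 2 ≤ Module.finrank ℝ E)
    (hf : ∀ i, ContDiff ℝ 2 (f i)) {L₁ L₂ Dg Dh m : ℝ} (hL₂ : 0 < L₂) (hDg : 0 < Dg) (hDh : 0 < Dh)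
    (hm : 0 < m) (hLg : ∀ i x y, ‖gradient (f i) x - gradient (f i) y‖ ≤ L₁ * ‖x - y‖)
    (hLh : ∀ i x y, ‖hess (f i) x - hess (f i) y‖ ≤ L₂ * ‖x - y‖) (r x : E)
    (hb : b = ⌈Dg / ‖x - r‖ ^ 2⌉₊) (hB : B = ⌈Dh⌉₊) :
    ((n : ℝ) ^ b)⁻¹ * ∑ I : Fin b → Fin n, ((n : ℝ) ^ B)⁻¹ * ∑ J : Fin B → Fin n,
      noise (average f) m x (gradEstimate f r x I) (hessEstimate f r x J) ≤
      L₂ ^ (3 / 2 : ℝ) * ((4 * L₁ ^ 2 / (Dg * L₂ ^ 2)) ^ (3 / 4 : ℝ)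
        + 1000 * L₂ ^ (3 / 2 : ℝ) * Real.log (Module.finrank ℝ E) ^ (3 / 2 : ℝ)
          / (m ^ (3 / 2 : ℝ) * Dh ^ (3 / 2 : ℝ))) * ‖x - r‖ ^ 3 := by
  have hn' : (0 : ℝ) < n := by exact_mod_cast hn
  have h1 := mean_gradEstimate_error_le hn hf hL₂ hDg hLg r x hb
  have h2 := mean_hessEstimate_error_le hn hd hf hL₂ hDh hLh r x hB
  have hm2 : 0 < m ^ (3 / 2 : ℝ) := by positivity
  have h3 := div_le_div_of_nonneg_right h2 hm2.le
  refine (le_of_eq ?_).trans ((add_le_add h1 h3).trans (le_of_eq ?_))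
  · simp only [noise, Finset.sum_add_distrib, mul_add, Finset.sum_const, Finset.card_univ,
      Fintype.card_fun, Fintype.card_fin, nsmul_eq_mul, Nat.cast_pow, ← Finset.sum_div,
      ← Finset.mul_sum]
    field_simp
  · field_simp

end MeanStep

/-! ### Expectations with values in `[0, ∞]`, free of integrability conditions. -/

section Expectation

variable {α β : Type*}

/-- The expectation of an extended nonnegative function. -/
def expect (p : PMF α) (g : α → ℝ≥0∞) : ℝ≥0∞ := ∑' a, p a * g a

theorem expect_pure (a : α) (g : α → ℝ≥0∞) : expect (PMF.pure a) g = g a := by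
  unfold expect
  rw [tsum_eq_single a fun b hb => by simp [hb]]
  simp

theorem expect_bind (p : PMF α) (q : α → PMF β) (g : β → ℝ≥0∞) :
    expect (p.bind q) g = expect p fun a => expect (q a) g := by
  simp only [expect, PMF.bind_apply, ← ENNReal.tsum_mul_right, ← ENNReal.tsum_mul_left]
  rw [ENNReal.tsum_comm]
  simp only [mul_assoc]

theorem expect_mono (p : PMF α) {g g' : α → ℝ≥0∞} (h : ∀ a, g a ≤ g' a) :
    expect p g ≤ expect p g' :=
  ENNReal.tsum_le_tsum fun a => by gcongr; exact h a

theorem expect_add_const (p : PMF α) (g : α → ℝ≥0∞) (k : ℝ≥0∞) :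
    expect p (fun a => g a + k) = expect p g + k := by
  simp only [expect, mul_add]
  rw [ENNReal.tsum_add, ENNReal.tsum_mul_right, p.tsum_coe, one_mul]

theorem expect_const_mul (p : PMF α) (g : α → ℝ≥0∞) (k : ℝ≥0∞) :
    expect p (fun a => k * g a) = k * expect p g := by
  simp only [expect, ← ENNReal.tsum_mul_left]
  exact tsum_congr fun a => mul_left_comm _ _ _

theorem expect_uniformOfFintype [Fintype α] [Nonempty α] {g : α → ℝ} (hg : ∀ a, 0 ≤ g a) :
    expect (PMF.uniformOfFintype α) (fun a => ENNReal.ofReal (g a)) =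
      ENNReal.ofReal ((Fintype.card α : ℝ)⁻¹ * ∑ a, g a) := by
  have hc : 0 < (Fintype.card α : ℝ) := by exact_mod_cast Fintype.card_pos
  rw [expect, tsum_fintype, ENNReal.ofReal_mul (by positivity),
    ENNReal.ofReal_sum_of_nonneg fun a _ => hg a, Finset.mul_sum, ENNReal.ofReal_inv_of_pos hc,
    ENNReal.ofReal_natCast]
  simp

theorem expect_uniformOfFinset (s : Finset α) (hs : s.Nonempty) (g : α → ℝ≥0∞) :
    expect (PMF.uniformOfFinset s hs) g = (s.card : ℝ≥0∞)⁻¹ * ∑ a ∈ s, g a := by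
  classical
  rw [expect, tsum_eq_sum (s := s) fun a ha => by simp [PMF.uniformOfFinset_apply, ha],
    Finset.mul_sum]
  exact Finset.sum_congr rfl fun a ha => by simp [PMF.uniformOfFinset_apply, ha]

end Expectation

section Vec

variable {n d : ℕ} (f : Fin n → Vec d → ℝ)

theorem hessian_eq_hess (F : Vec d → ℝ) : hessian F = hess F := rfl

theorem objective_eq_average : objective f = average f := rfl

theorem mu_eq_criterion (m : ℝ) (x : Vec d) : mu f m x = criterion (objective f) m x := rfl

end Vec

/-! ### The Lyapunov argument along the random run. -/

namespace Algorithm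

variable {n d : ℕ}

/-- The standing assumptions on the objective, the subproblem solver and the parameters. -/
structure Admissible (A : Algorithm n d) (L₁ L₂ : ℝ) (α β Γ c : ℕ → ℕ → ℝ) : Prop where
  two_le_dim : 2 ≤ d
  lipschitz_pos : 0 < L₂
  contDiff : ∀ i, ContDiff ℝ 2 (A.f i)
  gradient_lipschitz : ∀ i x y, ‖gradient (A.f i) x - gradient (A.f i) y‖ ≤ L₁ * ‖x - y‖
  hessian_lipschitz : ∀ i x y, ‖hessian (A.f i) x - hessian (A.f i) y‖ ≤ L₂ * ‖x - y‖
  bddBelow : BddBelow (Set.range (objective A.f))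
  solves : A.SolvesSubproblems
  Dg_pos : 0 < A.Dg
  Dh_pos : 0 < A.Dh
  lt_M : ∀ s ∈ Finset.Icc 1 A.S, ∀ t ∈ Finset.range A.T, 2 * L₂ < A.M s t
  weights_pos : ∀ s ∈ Finset.Icc 1 A.S, ∀ t ∈ Finset.range A.T, 0 < α s t ∧ 0 < β s t
  coeffs_pos : ∀ s ∈ Finset.Icc 1 A.S, ∀ t ∈ Finset.range A.T, 0 < Γ s t ∧ 0 < c s t
  Γ_eq : ∀ s ∈ Finset.Icc 1 A.S, ∀ t ∈ Finset.range A.T,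
    Γ s t = (A.M s t - 12 * c s (t + 1) * (1 + 2 * α s t + β s t)) / (12 * A.M s t ^ (3 / 2 : ℝ))
  c_eq : ∀ s ∈ Finset.Icc 1 A.S, ∀ t ∈ Finset.range A.T,
    c s t = (72 + Γ s t * A.M s t ^ (1 / 2 : ℝ)) * L₂ ^ (3 / 2 : ℝ) / A.M s t ^ (1 / 2 : ℝ)
        * ((4 * L₁ ^ 2 / (A.Dg * L₂ ^ 2)) ^ (3 / 4 : ℝ)
          + 1000 * L₂ ^ (3 / 2 : ℝ) * Real.log d ^ (3 / 2 : ℝ)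
            / (A.M s t ^ (3 / 2 : ℝ) * A.Dh ^ (3 / 2 : ℝ)))
      + c s (t + 1) * (1 + 1 / α s t ^ 2 + 2 / β s t ^ (1 / 2 : ℝ))
  c_last : ∀ s ∈ Finset.Icc 1 A.S, c s A.T = 0

variable (A : Algorithm n d)

/-- The suboptimality of a point. -/
def gap (x : Vec d) : ℝ := objective A.f x - ⨅ y, objective A.f y

/-- The Lyapunov function at iteration `t` of epoch `s`. -/
def lyapunov (c : ℕ → ℕ → ℝ) (s t : ℕ) (ω : Run d) : ℝ≥0∞ :=
  ENNReal.ofReal (A.gap (ω.iter s t) + c s t * ‖ω.iter s t - ω.hat (s - 1)‖ ^ 3)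

/-- The weighted stationarity measure of the iterate produced at iteration `t` of epoch `s`. -/
def reward (Γ : ℕ → ℕ → ℝ) (s t : ℕ) (ω : Run d) : ℝ≥0∞ :=
  ENNReal.ofReal (Γ s t / 300 * mu A.f (A.M s t) (ω.iter s (t + 1)))

/-- The total reward of the epochs `1, …, s`. -/
def epochsReward (Γ : ℕ → ℕ → ℝ) (s : ℕ) (ω : Run d) : ℝ≥0∞ :=
  ∑ s' ∈ Finset.Icc 1 s, ∑ t ∈ Finset.range A.T, A.reward Γ s' t ω

variable {A} {L₁ L₂ : ℝ} {α β Γ c : ℕ → ℕ → ℝ}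

namespace Admissible

/-- Subtracting the infimum makes the Lyapunov function nonnegative, so `ENNReal.ofReal` loses
nothing. -/
theorem gap_nonneg (h : A.Admissible L₁ L₂ α β Γ c) (x : Vec d) : 0 ≤ A.gap x := sub_nonneg.2 (ciInf_le h.bddBelow x)

theorem c_succ_nonneg (h : A.Admissible L₁ L₂ α β Γ c) {s t : ℕ}
    (hs : s ∈ Finset.Icc 1 A.S) (ht : t ∈ Finset.range A.T) :
    0 ≤ c s (t + 1) := by
  rcases Nat.lt_or_ge (t + 1) A.T with h' | h'
  · exact (h.coeffs_pos s hs (t + 1) (Finset.mem_range.2 h')).2.le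
  · have : t + 1 = A.T := by have := Finset.mem_range.1 ht; omega
    rw [this, h.c_last s hs]

/-- The decrease of the Lyapunov function for given estimates of the gradient and the Hessian. -/
theorem lyapunov_step_le [NeZero n] (h : A.Admissible L₁ L₂ α β Γ c) {s t : ℕ}
    (hs : s ∈ Finset.Icc 1 A.S) (ht : t ∈ Finset.range A.T) (ω : Run d) (v : Vec d) (U : Vec d →L[ℝ] Vec d)
    (hU : (U : Vec d →ₗ[ℝ] Vec d).IsSymmetric) (x r : Vec d) :
    A.gap (x + A.argminRule s t ω v U) + c s (t + 1) * ‖x + A.argminRule s t ω v U - r‖ ^ 3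
      + Γ s t / 300 * mu A.f (A.M s t) (x + A.argminRule s t ω v U) ≤
    A.gap x + (72 + Γ s t * A.M s t ^ (1 / 2 : ℝ)) / A.M s t ^ (1 / 2 : ℝ)
        * noise (average A.f) (A.M s t) x v U
      + c s (t + 1) * (1 + 1 / α s t ^ 2 + 2 / β s t ^ (1 / 2 : ℝ)) * ‖x - r‖ ^ 3 := by
  have key := lyapunov_le_of_cubic_step (F := average A.f) (L := L₂) (m := A.M s t) (x := x) (v := v)
    (h := A.argminRule s t ω v U) (U := U) (contDiff_average h.contDiff)
    (norm_hess_average_sub_le h.contDiff h.hessian_lipschitz) h.lipschitz_pos (h.lt_M s hs t ht) hU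
    (h.solves (s, t) (Finset.mem_product.2 ⟨hs, ht⟩) ω v U) (h.weights_pos s hs t ht).1
    (h.weights_pos s hs t ht).2 (h.coeffs_pos s hs t ht).1 (h.c_succ_nonneg hs ht)
    (h.Γ_eq s hs t ht) r
  rw [gap, gap, mu_eq_criterion, objective_eq_average]
  linarith

theorem lyapunov_add_reward_advance (h : A.Admissible L₁ L₂ α β Γ c) {s t : ℕ}
    (hs : s ∈ Finset.Icc 1 A.S) (ht : t ∈ Finset.range A.T) (ω : Run d) (v : Vec d)
    (U : Vec d →L[ℝ] Vec d) :
    A.lyapunov c s (t + 1) (A.advance s t ω v U) + A.reward Γ s t (A.advance s t ω v U) =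
      ENNReal.ofReal (A.gap (ω.iter s t + A.argminRule s t ω v U)
        + c s (t + 1) * ‖ω.iter s t + A.argminRule s t ω v U - ω.hat (s - 1)‖ ^ 3
        + Γ s t / 300 * mu A.f (A.M s t) (ω.iter s t + A.argminRule s t ω v U)) := by
  have h1 := h.c_succ_nonneg hs ht
  have h2 := (h.coeffs_pos s hs t ht).1
  have h3 := h.gap_nonneg (ω.iter s t + A.argminRule s t ω v U)
  have h4 := criterion_nonneg (objective A.f) (A.M s t) (ω.iter s t + A.argminRule s t ω v U)
  rw [← mu_eq_criterion] at h4
  rw [ENNReal.ofReal_add (p := _ + _) (by positivity) (by positivity)]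
  simp [lyapunov, reward, advance, Run.setIter]

theorem value_nonneg (h : A.Admissible L₁ L₂ α β Γ c) {s t : ℕ} (hs : s ∈ Finset.Icc 1 A.S)
    (ht : t ∈ Finset.range A.T) (y r : Vec d) :
    0 ≤ A.gap y + c s (t + 1) * ‖y - r‖ ^ 3 + Γ s t / 300 * mu A.f (A.M s t) y := by
  have h1 := h.c_succ_nonneg hs ht
  have h2 := (h.coeffs_pos s hs t ht).1
  have h3 := h.gap_nonneg y
  have h4 := criterion_nonneg (objective A.f) (A.M s t) y
  rw [← mu_eq_criterion] at h4
  positivity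

/-- The expected decrease of the Lyapunov function over the batches of one iteration. -/
theorem mean_lyapunov_step_le [NeZero n] (h : A.Admissible L₁ L₂ α β Γ c) {s t : ℕ}
    (hs : s ∈ Finset.Icc 1 A.S) (ht : t ∈ Finset.range A.T) (ω : Run d) (x r : Vec d)
    (Y : (Fin (A.gradBatch r x) → Fin n) → (Fin A.hessBatch → Fin n) → Vec d)
    (hY : ∀ I J, Y I J =
      x + A.argminRule s t ω (semiGradient A.f r x I) (semiHessian A.f r x J)) :
    ((n : ℝ) ^ A.gradBatch r x)⁻¹ * ∑ I, ((n : ℝ) ^ A.hessBatch)⁻¹ * ∑ J,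
      (A.gap (Y I J) + c s (t + 1) * ‖Y I J - r‖ ^ 3 + Γ s t / 300 * mu A.f (A.M s t) (Y I J)) ≤
      A.gap x + c s t * ‖x - r‖ ^ 3 := by
  have hn := Nat.pos_of_neZero n
  have hn' : (0 : ℝ) < n := by exact_mod_cast hn
  have hL := h.lipschitz_pos
  have hm := h.lt_M s hs t ht
  have hm0 : 0 < A.M s t := by linarith
  have hΓ := (h.coeffs_pos s hs t ht).1
  set K := (72 + Γ s t * A.M s t ^ (1 / 2 : ℝ)) / A.M s t ^ (1 / 2 : ℝ) with hK
  have hK0 : 0 ≤ K := by positivity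
  set k₂ := c s (t + 1) * (1 + 1 / α s t ^ 2 + 2 / β s t ^ (1 / 2 : ℝ)) with hk₂
  have hfin : Module.finrank ℝ (Vec d) = d := by simp
  have hnoise := mean_mean_noise_le (E := Vec d) (f := A.f) hn (by rw [hfin]; exact h.two_le_dim)
    h.contDiff hL h.Dg_pos h.Dh_pos hm0 h.gradient_lipschitz h.hessian_lipschitz r x
    (b := A.gradBatch r x) (B := A.hessBatch) rfl rfl
  rw [hfin] at hnoise
  calc ((n : ℝ) ^ A.gradBatch r x)⁻¹ * ∑ I, ((n : ℝ) ^ A.hessBatch)⁻¹ * ∑ J,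
      (A.gap (Y I J) + c s (t + 1) * ‖Y I J - r‖ ^ 3 + Γ s t / 300 * mu A.f (A.M s t) (Y I J))
      ≤ ((n : ℝ) ^ A.gradBatch r x)⁻¹ * ∑ I : Fin (A.gradBatch r x) → Fin n,
        ((n : ℝ) ^ A.hessBatch)⁻¹ * ∑ J : Fin A.hessBatch → Fin n,
        (A.gap x + K * noise (average A.f) (A.M s t) x (gradEstimate A.f r x I)
          (hessEstimate A.f r x J) + k₂ * ‖x - r‖ ^ 3) := by
        refine mul_le_mul_of_nonneg_left (Finset.sum_le_sum fun I _ =>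
          mul_le_mul_of_nonneg_left (Finset.sum_le_sum fun J _ => ?_) (by positivity))
          (by positivity)
        rw [hY]
        exact h.lyapunov_step_le hs ht ω _ _ (isSymmetric_hessEstimate h.contDiff r x J) x r
    _ = A.gap x + K * (((n : ℝ) ^ A.gradBatch r x)⁻¹ * ∑ I : Fin (A.gradBatch r x) → Fin n,
        ((n : ℝ) ^ A.hessBatch)⁻¹ * ∑ J : Fin A.hessBatch → Fin n,
        noise (average A.f) (A.M s t) x (gradEstimate A.f r x I)
          (hessEstimate A.f r x J)) + k₂ * ‖x - r‖ ^ 3 := by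
        simp only [Finset.sum_add_distrib, mul_add, Finset.sum_const, Finset.card_univ,
          Fintype.card_fun, Fintype.card_fin, nsmul_eq_mul, Nat.cast_pow, ← Finset.mul_sum]
        field_simp
    _ ≤ _ := by
        have h1 := mul_le_mul_of_nonneg_left hnoise hK0
        -- The recursion for `c` is exactly `K` times the noise coefficient plus `k₂`.
        rw [h.c_eq s hs t ht, ← hk₂]
        refine (add_le_add (add_le_add le_rfl h1) le_rfl).trans (le_of_eq ?_)
        rw [hK]
        ring

/-- `Φ` stands for the rewards already collected, which recording the next iterate leaves unchanged.
-/
theorem expect_step_le [NeZero n] (h : A.Admissible L₁ L₂ α β Γ c) {s t : ℕ}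
    (hs : s ∈ Finset.Icc 1 A.S) (ht : t ∈ Finset.range A.T) (ω : Run d)
    (h0 : t = 0 → ω.iter s 0 = ω.hat (s - 1)) (Φ : Run d → ℝ≥0∞)
    (hΦ : ∀ y, Φ (ω.setIter s (t + 1) y) = Φ ω) :
    expect (A.step s t ω) (fun ω' => A.lyapunov c s (t + 1) ω' + A.reward Γ s t ω' + Φ ω') ≤
      A.lyapunov c s t ω + Φ ω := by
  have hΦ' : ∀ v U, Φ (A.advance s t ω v U) = Φ ω := fun v U => hΦ _
  unfold step
  by_cases htz : t = 0
  -- At `t = 0` the derivatives are exact and `x = r`, so the noise and the cubic distance both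
  -- vanish.
  · subst htz
    have hx := h0 rfl
    simp only [if_true, expect_pure, hΦ', h.lyapunov_add_reward_advance hs ht]
    gcongr
    have key := h.lyapunov_step_le hs ht ω (gradient (objective A.f) (ω.hat (s - 1)))
      (hessian (objective A.f) (ω.hat (s - 1)))
      (isSymmetric_hess (contDiff_average h.contDiff) _) (ω.iter s 0) (ω.hat (s - 1))
    have hz : noise (average A.f) (A.M s 0) (ω.iter s 0)
        (gradient (objective A.f) (ω.hat (s - 1))) (hessian (objective A.f) (ω.hat (s - 1)))
        = 0 := by
      rw [hx, objective_eq_average, hessian_eq_hess]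
      simp [noise]
    rw [hz] at key
    unfold lyapunov
    refine ENNReal.ofReal_le_ofReal (key.trans (le_of_eq ?_))
    rw [hx]
    simp
  · simp only [if_neg htz, expect_bind, expect_pure, hΦ', expect_add_const,
      h.lyapunov_add_reward_advance hs ht]
    gcongr
    have hv := fun (I : Fin (A.gradBatch (ω.hat (s - 1)) (ω.iter s t)) → Fin n)
      (J : Fin A.hessBatch → Fin n) => h.value_nonneg hs ht
        (ω.iter s t + A.argminRule s t ω (semiGradient A.f (ω.hat (s - 1)) (ω.iter s t) I)
          (semiHessian A.f (ω.hat (s - 1)) (ω.iter s t) J)) (ω.hat (s - 1))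
    simp only [expect_uniformOfFintype (hv _)]
    rw [expect_uniformOfFintype fun I => mul_nonneg (by positivity)
      (Finset.sum_nonneg fun J _ => hv I J)]
    refine ENNReal.ofReal_le_ofReal ?_
    simp only [Fintype.card_fun, Fintype.card_fin, Nat.cast_pow]
    exact h.mean_lyapunov_step_le hs ht ω _ _ _ fun I J => rfl

theorem epochsReward_setIter {s s' t : ℕ} (hs : s < s') (ω : Run d) (y : Vec d) :
    A.epochsReward Γ s (ω.setIter s' t y) = A.epochsReward Γ s ω := by
  unfold epochsReward
  refine Finset.sum_congr rfl fun i hi => Finset.sum_congr rfl fun j _ => ?_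
  have : i ≠ s' := by have := Finset.mem_Icc.1 hi; omega
  simp [reward, Run.setIter, this]

theorem expect_innerLoop_le [NeZero n] (h : A.Admissible L₁ L₂ α β Γ c) {s : ℕ}
    (hs : s ∈ Finset.Icc 1 A.S) (ω : Run d) {t : ℕ} (ht : t ≤ A.T) :
    expect (A.innerLoop s ω t) (fun ω' => A.lyapunov c s t ω'
      + (A.epochsReward Γ (s - 1) ω' + ∑ j ∈ Finset.range t, A.reward Γ s j ω')) ≤
      ENNReal.ofReal (A.gap (ω.hat (s - 1))) + A.epochsReward Γ (s - 1) ω := by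
  have hs1 : s - 1 < s := by have := Finset.mem_Icc.1 hs; omega
  induction t with
  | zero =>
    simp only [innerLoop, expect_pure, epochsReward_setIter hs1]
    simp [lyapunov, Run.setIter]
  | succ t ih =>
    have ht' : t ∈ Finset.range A.T := Finset.mem_range.2 (by omega)
    set Φ : Run d → ℝ≥0∞ := fun ω' =>
      A.epochsReward Γ (s - 1) ω' + ∑ j ∈ Finset.range t, A.reward Γ s j ω' with hΦ
    have hΦ' : ∀ ω' y, Φ (Run.setIter ω' s (t + 1) y) = Φ ω' := by
      intro ω' y
      simp only [hΦ, epochsReward_setIter hs1]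
      congr 1
      refine Finset.sum_congr rfl fun j hj => ?_
      have : j ≠ t := by have := Finset.mem_range.1 hj; omega
      simp [reward, Run.setIter, this]
    have hsplit : ∀ ω', A.lyapunov c s (t + 1) ω' + (A.epochsReward Γ (s - 1) ω'
        + ∑ j ∈ Finset.range (t + 1), A.reward Γ s j ω')
        = A.lyapunov c s (t + 1) ω' + A.reward Γ s t ω' + Φ ω' := fun ω' => by
      simp only [hΦ, Finset.sum_range_succ]
      ring
    simp only [hsplit, innerLoop, expect_bind]
    refine le_trans ?_ (ih (by omega))
    -- Only the actual initial state of the epoch is known to satisfy `x = r`, so `t = 0` is not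
    -- treated pointwise over arbitrary states.
    rcases Nat.eq_zero_or_pos t with rfl | htpos
    · simp only [innerLoop, expect_pure]
      exact h.expect_step_le hs ht' _ (fun _ => by simp [Run.setIter]) Φ (hΦ' _)
    · exact expect_mono _ fun ω' => h.expect_step_le hs ht' ω' (by omega) Φ (hΦ' ω')

/-- Since `c_{s,T} = 0`, the final Lyapunov value is the gap at the new reference point, so
consecutive epochs telescope. -/
theorem expect_epoch_le [NeZero n] (h : A.Admissible L₁ L₂ α β Γ c) {s : ℕ}
    (hs : s + 1 ∈ Finset.Icc 1 A.S) (ω : Run d) :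
    expect (A.epoch (s + 1) ω) (fun ω' => ENNReal.ofReal (A.gap (ω'.hat (s + 1)))
      + A.epochsReward Γ (s + 1) ω') ≤
      ENNReal.ofReal (A.gap (ω.hat s)) + A.epochsReward Γ s ω := by
  have key := h.expect_innerLoop_le hs ω le_rfl
  rw [Nat.add_sub_cancel] at key
  simp only [epoch, expect_bind, expect_pure]
  refine le_trans (expect_mono _ fun ω' => le_of_eq ?_) key
  rw [epochsReward, Finset.sum_Icc_succ_top (by omega)]
  simp [lyapunov, epochsReward, reward, Run.setHat, h.c_last _ hs]

theorem expect_run_le [NeZero n] (h : A.Admissible L₁ L₂ α β Γ c) {s : ℕ} (hs : s ≤ A.S) :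
    expect (A.run s) (fun ω => ENNReal.ofReal (A.gap (ω.hat s)) + A.epochsReward Γ s ω) ≤
      ENNReal.ofReal (A.gap A.x₀) := by
  induction s with
  | zero => simp [run, expect_pure, epochsReward]
  | succ s ih =>
    simp only [run, expect_bind]
    refine le_trans (expect_mono _ fun ω => h.expect_epoch_le ?_ ω) (ih (by omega))
    exact Finset.mem_Icc.2 ⟨by omega, hs⟩

theorem expectedMu_le [NeZero n] (h : A.Admissible L₁ L₂ α β Γ c) (hS : 1 ≤ A.S) (hT : 1 ≤ A.T) :
    A.expectedMu hS hT ≤ ENNReal.ofReal (optimalGap A.f A.x₀ / (A.S * A.T *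
      A.indices.inf' (A.indices_nonempty hS hT) (fun p => Γ p.1 p.2 / 300))) := by
  set γ := A.indices.inf' (A.indices_nonempty hS hT) (fun p => Γ p.1 p.2 / 300) with hγ
  have hγ0 : 0 < γ := by
    refine (Finset.lt_inf'_iff _).2 fun p hp => ?_
    have hp' := Finset.mem_product.1 hp
    have := (h.coeffs_pos p.1 hp'.1 p.2 hp'.2).1
    positivity
  have hS' : (0 : ℝ) < A.S := by exact_mod_cast hS
  have hT' : (0 : ℝ) < A.T := by exact_mod_cast hT
  have hcard : A.indices.card = A.S * A.T := by simp [indices]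
  have h1 : A.expectedMu hS hT = (A.indices.card : ℝ≥0∞)⁻¹ * expect (A.run A.S) (fun ω =>
      ∑ p ∈ A.indices, ENNReal.ofReal (mu A.f (A.M p.1 p.2) (ω.iter p.1 (p.2 + 1)))) := by
    change expect (A.output hS hT) (fun o => ENNReal.ofReal (mu A.f (A.M o.1.1 o.1.2) o.2)) = _
    simp only [output, expect_bind, expect_pure, expect_uniformOfFinset, expect_const_mul]
  -- Each weight `Γ/300` is at least `γ`, and the final gap is dropped as nonnegative.
  have h2 : ENNReal.ofReal γ * expect (A.run A.S) (fun ω =>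
      ∑ p ∈ A.indices, ENNReal.ofReal (mu A.f (A.M p.1 p.2) (ω.iter p.1 (p.2 + 1))))
      ≤ ENNReal.ofReal (A.gap A.x₀) := by
    rw [← expect_const_mul]
    refine le_trans (expect_mono _ fun ω => ?_) (h.expect_run_le le_rfl)
    refine le_trans ?_ le_add_self
    rw [epochsReward, ← Finset.sum_product', Finset.mul_sum]
    refine Finset.sum_le_sum fun p hp => ?_
    have hp' := Finset.mem_product.1 hp
    have hle : γ ≤ Γ p.1 p.2 / 300 := Finset.inf'_le (fun p => Γ p.1 p.2 / 300) hp
    rw [← ENNReal.ofReal_mul hγ0.le]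
    refine ENNReal.ofReal_le_ofReal (mul_le_mul_of_nonneg_right hle ?_)
    exact criterion_nonneg (objective A.f) _ _
  have hpos : 0 < (A.S * A.T : ℝ) := by positivity
  have h3 : (A.indices.card : ℝ≥0∞)⁻¹ = ENNReal.ofReal (A.S * A.T : ℝ)⁻¹ := by
    rw [ENNReal.ofReal_inv_of_pos hpos, hcard, ← Nat.cast_mul, ENNReal.ofReal_natCast]
  have h4 : optimalGap A.f A.x₀ / (A.S * A.T * γ) = (A.S * A.T : ℝ)⁻¹ * (γ⁻¹ * A.gap A.x₀) := by
    rw [gap, ← optimalGap]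
    field_simp
  rw [h1, h3, h4, ENNReal.ofReal_mul (by positivity), ENNReal.ofReal_mul (by positivity),
    ENNReal.ofReal_inv_of_pos hγ0]
  gcongr
  rw [← ENNReal.div_eq_inv_mul, ENNReal.le_div_iff_mul_le (Or.inl (by simpa using hγ0))
    (Or.inl ENNReal.ofReal_ne_top), mul_comm]
  exact h2

end Admissible

end Algorithm

end LiteSVRC

end

/-! ### The theorem with explicit constants. -/

theorem theorem1 :
    ∃ C₁ Ch Cμ : ℝ, 0 < C₁ ∧ 0 < Ch ∧ 0 < Cμ ∧
      ∀ (n d : ℕ) [NeZero n] (A : LiteSVRC.Algorithm n d) (L₁ L₂ : ℝ)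
        (α β Γ c : ℕ → ℕ → ℝ) (hS : 1 ≤ A.S) (hT : 1 ≤ A.T),
        10 < n → 2 ≤ d →
        0 < L₁ → 0 < L₂ →
        (∀ i, ContDiff ℝ 2 (A.f i)) →
        (∀ i x y, ‖gradient (A.f i) x - gradient (A.f i) y‖ ≤ L₁ * ‖x - y‖) →
        (∀ i x y, ‖LiteSVRC.hessian (A.f i) x - LiteSVRC.hessian (A.f i) y‖ ≤ L₂ * ‖x - y‖) →
        BddBelow (Set.range (LiteSVRC.objective A.f)) →
        A.SolvesSubproblems →
        0 < A.Dg →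
        25 * Real.log d < A.Dh →
        (∀ s ∈ Finset.Icc 1 A.S, ∀ t ∈ Finset.range A.T, 2 * L₂ < A.M s t) →
        (∀ s ∈ Finset.Icc 1 A.S, ∀ t ∈ Finset.range A.T, 0 < α s t ∧ 0 < β s t) →
        (∀ s ∈ Finset.Icc 1 A.S, ∀ t ∈ Finset.range A.T, 0 < Γ s t ∧ 0 < c s t) →
        (∀ s ∈ Finset.Icc 1 A.S, ∀ t ∈ Finset.range A.T,
          Γ s t = (A.M s t - 12 * c s (t + 1) * (1 + 2 * α s t + β s t))
            / (12 * A.M s t ^ (3 / 2 : ℝ))) →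
        (∀ s ∈ Finset.Icc 1 A.S, ∀ t ∈ Finset.range A.T,
          c s t = (C₁ + Γ s t * A.M s t ^ (1 / 2 : ℝ)) * L₂ ^ (3 / 2 : ℝ) / A.M s t ^ (1 / 2 : ℝ)
              * ((4 * L₁ ^ 2 / (A.Dg * L₂ ^ 2)) ^ (3 / 4 : ℝ)
                + Ch * L₂ ^ (3 / 2 : ℝ) * Real.log d ^ (3 / 2 : ℝ)
                  / (A.M s t ^ (3 / 2 : ℝ) * A.Dh ^ (3 / 2 : ℝ)))
            + c s (t + 1) * (1 + 1 / α s t ^ 2 + 2 / β s t ^ (1 / 2 : ℝ))) →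
        (∀ s ∈ Finset.Icc 1 A.S, c s A.T = 0) →
        A.expectedMu hS hT ≤
          ENNReal.ofReal (LiteSVRC.optimalGap A.f A.x₀ /
            (A.S * A.T *
              A.indices.inf' (A.indices_nonempty hS hT) (fun p => Γ p.1 p.2 / Cμ))) := by
  -- 72 comes from the Young inequality `mul_sq_le_cubes`, 1000 from the Hessian moment bound and
  -- 300 from bounding `μ` by the step length and the noise.
  refine ⟨72, 1000, 300, by norm_num, by norm_num, by norm_num, ?_⟩
  intro n d _ A L₁ L₂ α β Γ c hS hT _ hd _ hL₂ hf hLg hLh hbdd hsolve hDg hDh hM hαβ hΓc hΓ hc hcT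
  have hlog : 0 ≤ Real.log d := Real.log_natCast_nonneg d
  exact LiteSVRC.Algorithm.Admissible.expectedMu_le ⟨hd, hL₂, hf, hLg, hLh, hbdd, hsolve, hDg,
    by linarith, hM, hαβ, hΓc, hΓ, hc, hcT⟩ hS hT
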